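/- An ordered rooted tree is a finite rooted tree (of arbitrary arity) with a fixed left-to-right order of the children at every node; $T_v$ denotes the subtree rooted at a node $v$. A straight-line drawing of such a tree $T$ places the nodes at distinct points of the integer grid and draws every edge as a straight segment. It is *planar* if two distinct edges meet at most in a common endpoint, *order-preserving* if around every node the edges to the children appear in their given order, counterclockwise starting from the edge to the parent (for the root: from the upward vertical direction), and *strictly upward* if every node lies strictly above its proper descendants. For a root-to-leaf path $\pi$, a *left* (resp. *right*) *subtree* of $\pi$ is a subtree rooted at a child that comes before (resp. after) the path-child at some node of $\pi$. A planar order-preserving straight-line drawing is a *GLR-drawing* if for every node $v$ the induced drawing of $T_v$ has a root-to-leaf path $\pi=\langle v_1,\dots,v_\ell\rangle$ drawn in one column, with $v_i$ above $v_{i+1}$ for $1\le i<\ell$, such that the drawings of all left subtrees of $\pi$ lie strictly to the left of this column and those of all right subtrees strictly to the right. The width (height) of a drawing is the number of grid columns (rows) that it intersects, and its area is the number of grid points in its bounding box. A drawing is of *type I* if the root is in the top row, and of *type III$\ell$* (*III$r$*) if the root is in the top left (top right) corner of the bounding box. Let $p=0.48$. There are constants $c>0$ and $C>0$ such that every ordered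 rooted tree with $n\ge 1$ nodes has - a straight-line strictly upward GLR-drawing of type I of width at most $c\,n^p-1$, - a straight-line strictly upward GLR-drawing of type III$\ell$ of width at most $c\,n^p$, and - a straight-line strictly upward GLR-drawing of type III$r$ of width at most $c\,n^p$, where each of the three drawings has height at most $2n^{1+p}$ and hence area at most $C\,n^{1.96}$. -/

import Mathlib

/-- Finite ordered rooted trees of arbitrary arity: a root together with the finite sequence
(from left to right) of the subtrees rooted at its children. -/
inductive OrderedTree : Type
  | node (d : ℕ) (ch : Fin d → OrderedTree) : OrderedTree

namespace OrderedTree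

/-- The number of nodes of a tree. -/
def size : OrderedTree → ℕ
  | node _ ch => 1 + ∑ i, (ch i).size

/-- The nodes of an ordered rooted tree: the root, or a node of the subtree at the `i`-th child. -/
inductive Vertex : OrderedTree → Type
  | root {T : OrderedTree} : Vertex T
  | child {d : ℕ} {ch : Fin d → OrderedTree} (i : Fin d) (v : Vertex (ch i)) : Vertex (node d ch)

namespace Vertex

/-- A node is the root or lies in exactly one of the subtrees at the children of the root. -/
def equivOption (d : ℕ) (ch : Fin d → OrderedTree) :
    Vertex (node d ch) ≃ Option (Σ i, Vertex (ch i)) where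
  toFun v := match v with
    | root => none
    | child i v => some ⟨i, v⟩
  invFun o := match o with
    | none => root
    | some ⟨i, v⟩ => child i v
  left_inv v := by cases v <;> rfl
  right_inv o := by rcases o with _ | ⟨i, v⟩ <;> rfl

/-- A tree has finitely many nodes. -/
instance instFintypeVertex : (T : OrderedTree) → Fintype (Vertex T)
  | node d ch =>
    haveI : ∀ i, Fintype (Vertex (ch i)) := fun i => instFintypeVertex (ch i)
    Fintype.ofEquiv _ (equivOption d ch).symm

/-- The number of children of a node. -/
def arity : {T : OrderedTree} → Vertex T → ℕ
  | node d _, root => d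
  | _, child _ v => v.arity

/-- The `i`-th child (from the left) of a node. -/
def kid : {T : OrderedTree} → (v : Vertex T) → Fin v.arity → Vertex T
  | node _ _, root, i => child i root
  | _, child j v, i => child j (v.kid i)

/-- The subtree rooted at a node: the node together with all its descendants. -/
def subtree : {T : OrderedTree} → Vertex T → OrderedTree
  | T, root => T
  | _, child _ v => v.subtree

/-- The nodes of the subtree rooted at `v`, as nodes of the whole tree. -/
def embed : {T : OrderedTree} → (v : Vertex T) → Vertex v.subtree → Vertex T
  | _, root, w => w
  | _, child i v, w => child i (v.embed w)

end Vertex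

open Vertex

/-- The root-to-leaf paths of a tree, given by the choice of a child at every non-leaf reached. -/
inductive LeafPath : OrderedTree → Type
  | leaf {ch : Fin 0 → OrderedTree} : LeafPath (node 0 ch)
  | step {d : ℕ} {ch : Fin d → OrderedTree} (i : Fin d) (π : LeafPath (ch i)) :
      LeafPath (node d ch)

/-- The node `v` belongs to the path `π`. -/
inductive OnPath : {T : OrderedTree} → LeafPath T → Vertex T → Prop
  | root {T : OrderedTree} (π : LeafPath T) : OnPath π Vertex.root
  | step {d : ℕ} {ch : Fin d → OrderedTree} {i : Fin d} {π : LeafPath (ch i)} {v : Vertex (ch i)} :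
      OnPath π v → OnPath (LeafPath.step (ch := ch) i π) (Vertex.child i v)

/-- The node `v` belongs to a left subtree of `π`, i.e. to a subtree rooted at a child that comes
before the path-child in the order at some node of `π`. -/
inductive InLeftSubtree : {T : OrderedTree} → LeafPath T → Vertex T → Prop
  | here {d : ℕ} {ch : Fin d → OrderedTree} {i j : Fin d} {π : LeafPath (ch i)}
      {v : Vertex (ch j)} :
      j < i → InLeftSubtree (LeafPath.step (ch := ch) i π) (Vertex.child j v)
  | deeper {d : ℕ} {ch : Fin d → OrderedTree} {i : Fin d} {π : LeafPath (ch i)}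
      {v : Vertex (ch i)} :
      InLeftSubtree π v → InLeftSubtree (LeafPath.step (ch := ch) i π) (Vertex.child i v)

/-- The node `v` belongs to a right subtree of `π`, i.e. to a subtree rooted at a child that comes
after the path-child in the order at some node of `π`. -/
inductive InRightSubtree : {T : OrderedTree} → LeafPath T → Vertex T → Prop
  | here {d : ℕ} {ch : Fin d → OrderedTree} {i j : Fin d} {π : LeafPath (ch i)}
      {v : Vertex (ch j)} :
      i < j → InRightSubtree (LeafPath.step (ch := ch) i π) (Vertex.child j v)
  | deeper {d : ℕ} {ch : Fin d → OrderedTree} {i : Fin d} {π : LeafPath (ch i)}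
      {v : Vertex (ch i)} :
      InRightSubtree π v → InRightSubtree (LeafPath.step (ch := ch) i π) (Vertex.child i v)

/-- A straight-line drawing on the integer grid is determined by the grid points `(x, y)` at which
the nodes are placed; every edge is drawn as the segment between its ends. The `y`-axis points
upward, so a node is above another one if its `y`-coordinate is larger. -/
abbrev StraightLineDrawing (T : OrderedTree) : Type := Vertex T → ℤ × ℤ

/-- A grid point as a point of the real plane. -/
def gridPoint (P : ℤ × ℤ) : ℝ × ℝ := ((P.1 : ℝ), (P.2 : ℝ))

/-- The cross product of two vectors in the plane. -/
def cross (a b : ℤ × ℤ) : ℤ := a.1 * b.2 - a.2 * b.1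

/-- The directions `a`, `b`, `c` are pairwise distinct and appear in this counterclockwise cyclic
order. (This holds iff at least two of the three consecutive cross products are positive, also
when two of the directions are opposite.) -/
def CounterClockwise (a b c : ℤ × ℤ) : Prop :=
  (0 < cross a b ∧ 0 < cross b c) ∨ (0 < cross b c ∧ 0 < cross c a) ∨
    (0 < cross c a ∧ 0 < cross a b)

namespace StraightLineDrawing

variable {T : OrderedTree}

/-- The drawing of the edge from `v` to its `i`-th child. -/
def edge (Γ : StraightLineDrawing T) (v : Vertex T) (i : Fin v.arity) : Set (ℝ × ℝ) :=
  segment ℝ (gridPoint (Γ v)) (gridPoint (Γ (v.kid i)))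

/-- Planarity: distinct nodes are at distinct points, and two distinct edges meet at most in a
common end. (An edge is identified by its lower end. No edge passes through a node that is not
one of its ends, since such a node is an end of another edge.) -/
def IsPlanar (Γ : StraightLineDrawing T) : Prop :=
  Function.Injective Γ ∧
    ∀ (v w : Vertex T) (i : Fin v.arity) (j : Fin w.arity), v.kid i ≠ w.kid j →
      Γ.edge v i ∩ Γ.edge w j ⊆
        (fun u => gridPoint (Γ u)) '' ({v, v.kid i} ∩ {w, w.kid j})

/-- The drawing respects the order of children: going counterclockwise around a node, starting at
the edge to the parent (for the root: at the upward vertical direction), one meets the edges to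
the children in their given order from left to right. -/
def IsOrderPreserving (Γ : StraightLineDrawing T) : Prop :=
  (∀ i j : Fin (root : Vertex T).arity, i < j →
    CounterClockwise (0, 1) (Γ (kid root i) - Γ root) (Γ (kid root j) - Γ root)) ∧
  ∀ (u : Vertex T) (k : Fin u.arity) (i j : Fin (u.kid k).arity), i < j →
    CounterClockwise (Γ u - Γ (u.kid k)) (Γ ((u.kid k).kid i) - Γ (u.kid k))
      (Γ ((u.kid k).kid j) - Γ (u.kid k))

/-- Every node is strictly above all its proper descendants. -/
def IsStrictlyUpward (Γ : StraightLineDrawing T) : Prop :=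
  ∀ (v : Vertex T) (w : Vertex v.subtree), w ≠ root → (Γ (v.embed w)).2 < (Γ v).2

/-- The drawing of the subtree rooted at `v` induced by `Γ`. -/
def induced (Γ : StraightLineDrawing T) (v : Vertex T) : StraightLineDrawing v.subtree :=
  fun w => Γ (v.embed w)

/-- The path `π` is drawn vertically aligned in the column `a`, every node of it above the next. -/
def IsVerticalPath (Γ : StraightLineDrawing T) (π : LeafPath T) (a : ℤ) : Prop :=
  (∀ v, OnPath π v → (Γ v).1 = a) ∧
    ∀ (v : Vertex T) (i : Fin v.arity), OnPath π v → OnPath π (v.kid i) →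
      (Γ (v.kid i)).2 < (Γ v).2

/-- The column `a` separates the left from the right subtrees of `π`: the drawings of the former
are strictly to the left of the column, those of the latter strictly to the right. (Edges are
segments, so this only needs to be said for the nodes.) -/
def IsSeparatedBy (Γ : StraightLineDrawing T) (π : LeafPath T) (a : ℤ) : Prop :=
  (∀ v, InLeftSubtree π v → (Γ v).1 < a) ∧ ∀ v, InRightSubtree π v → a < (Γ v).1

/-- Generalized LR-drawings (straight-line): planar order-preserving drawings such that the
induced drawing of every rooted subtree (including the whole tree) has a vertically drawn
root-to-leaf path whose column separates its left from its right subtrees. -/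
def IsGLR (Γ : StraightLineDrawing T) : Prop :=
  Γ.IsPlanar ∧ Γ.IsOrderPreserving ∧
    ∀ v : Vertex T, ∃ (π : LeafPath v.subtree) (a : ℤ),
      (Γ.induced v).IsVerticalPath π a ∧ (Γ.induced v).IsSeparatedBy π a

/-- The leftmost column of the bounding box. -/
def leftColumn (Γ : StraightLineDrawing T) : ℤ :=
  Finset.univ.inf' ⟨root, Finset.mem_univ _⟩ fun v => (Γ v).1

/-- The rightmost column of the bounding box. -/
def rightColumn (Γ : StraightLineDrawing T) : ℤ :=
  Finset.univ.sup' ⟨root, Finset.mem_univ _⟩ fun v => (Γ v).1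

/-- The bottom row of the bounding box. -/
def bottomRow (Γ : StraightLineDrawing T) : ℤ :=
  Finset.univ.inf' ⟨root, Finset.mem_univ _⟩ fun v => (Γ v).2

/-- The top row of the bounding box. -/
def topRow (Γ : StraightLineDrawing T) : ℤ :=
  Finset.univ.sup' ⟨root, Finset.mem_univ _⟩ fun v => (Γ v).2

/-- The number of columns of the grid that meet the drawing. -/
def width (Γ : StraightLineDrawing T) : ℤ := Γ.rightColumn - Γ.leftColumn + 1

/-- The number of rows of the grid that meet the drawing. -/
def height (Γ : StraightLineDrawing T) : ℤ := Γ.topRow - Γ.bottomRow + 1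

/-- The number of grid points in the bounding box. -/
def area (Γ : StraightLineDrawing T) : ℤ := Γ.width * Γ.height

/-- Type I: the root is in the top row. -/
def IsTypeI (Γ : StraightLineDrawing T) : Prop := (Γ root).2 = Γ.topRow

/-- Type IIIℓ: the root is in the top left corner of the bounding box. -/
def IsTypeIIIl (Γ : StraightLineDrawing T) : Prop :=
  (Γ root).1 = Γ.leftColumn ∧ (Γ root).2 = Γ.topRow

/-- Type IIIr: the root is in the top right corner of the bounding box. -/
def IsTypeIIIr (Γ : StraightLineDrawing T) : Prop :=
  (Γ root).1 = Γ.rightColumn ∧ (Γ root).2 = Γ.topRow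

end StraightLineDrawing

end OrderedTree

/-! Let p = 12/25. The core is combinatorial (`exists_balanced_path`): some root-to-leaf path has
largest left and right subtrees of sizes α, β with α^p + β^p ≤ 0.9999 n^p. Draw it vertically, with
the left subtrees (type IIIr) and the right subtrees (type IIIℓ) stacked along it in disjoint rows.
The width then depends on α and β only, and by induction it is at most c (α^p + β^p) plus a
constant, which the deficit 0.0001 c n^p absorbs for c = 20000.

The path is found by descent, assuming that no path works. The largest left and right subtrees met
so far stay balanced, and a further pair of subtrees with too large a power sum is carried along
(`DescentInvariant`). When a maximum changes, the failure of another path supplies such a pair anew;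
when no child keeps the balance, further such pairs appear. By concavity of x^p, three of them do
not fit into n nodes (`no_three_large_power_sums` and its primed variant); this is where the value
of p matters.

For a corner drawing, the first child goes to the column of the root and the others start in column
1 (`fits_corner`). This exceeds the bound only if another child b carries nearly the whole power.
Then b gets a type I drawing, whose bound is smaller by one column. The edge to its root must pass
below the later siblings; enough empty rows above b make this edge so steep that they may start
halfway, and they are small enough for this to fit in rows and columns.

Planarity, order and upwardness all follow from the recursive certificate `IsTidy`, which stacking
preserves (`fitsAlong_node`). -/

namespace OrderedTree

/-! ### Tangent bounds for x^(12/25) -/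

/-- The tangent of the concave function `x ↦ x ^ (12 / 25)` at `u ^ 25` lies above its graph. -/
theorem rpow_le_tangent {x u : ℝ} (hx : 0 ≤ x) (hu : 0 < u) :
    x ^ (12 / 25 : ℝ) ≤ u ^ 12 * (13 / 25) + x * (12 / 25 / u ^ 13) := by
  have h25 : 0 < u ^ 25 := by positivity
  -- Weighted AM-GM for `x / u ^ 25` and `1`. Taking a 25th power as the point of tangency keeps the
  -- coefficients rational in `u`.
  have h := Real.geom_mean_le_arith_mean2_weighted (w₁ := 12 / 25) (w₂ := 13 / 25)
    (p₁ := x / u ^ 25) (p₂ := 1) (by norm_num) (by norm_num) (by positivity) (by norm_num)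
    (by norm_num)
  rw [Real.one_rpow, mul_one, Real.div_rpow hx h25.le] at h
  have hu12 : (u ^ 25 : ℝ) ^ (12 / 25 : ℝ) = u ^ 12 := by
    rw [← Real.rpow_natCast, ← Real.rpow_mul hu.le, ← Real.rpow_natCast]
    norm_num
  rw [hu12, div_le_iff₀ (by positivity)] at h
  refine h.trans (le_of_eq ?_)
  field_simp
  ring

/-- After replacing each power by a tangent, only a linear inequality remains. The values `u ^ 25`
(about 0.177, 0.300, 0.604, 0.040) approximate a nearly tight configuration with a = b and L = R = s
/ 2. -/
theorem no_three_large_power_sums {a R b L g s : ℝ} (ha : 0 ≤ a) (hR : 0 ≤ R) (hb : 0 ≤ b)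
    (hL : 0 ≤ L) (hg : 0 ≤ g) (hs : L + R ≤ s) (hsum : a + b + g + s ≤ 1)
    (h1 : 9999 / 10000 < a ^ (12 / 25 : ℝ) + R ^ (12 / 25 : ℝ))
    (h2 : 9999 / 10000 < L ^ (12 / 25 : ℝ) + b ^ (12 / 25 : ℝ))
    (h3 : 9999 / 10000 < g ^ (12 / 25 : ℝ) + s ^ (12 / 25 : ℝ)) : False := by
  have ta := rpow_le_tangent ha (u := 0.933) (by norm_num)
  have tb := rpow_le_tangent hb (u := 0.933) (by norm_num)
  have tR := rpow_le_tangent hR (u := 0.953) (by norm_num)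
  have tL := rpow_le_tangent hL (u := 0.953) (by norm_num)
  have ts := rpow_le_tangent (x := s) (by linarith) (u := 0.98) (by norm_num)
  have tg := rpow_le_tangent hg (u := 0.879) (by norm_num)
  norm_num at ta tb tR tL ts tg
  linarith

/-- Here `M` occurs in two of the sums. The tangents are taken near a = b and x = y, where all three
power sums are about 1. -/
theorem no_three_large_power_sums' {x y a M b : ℝ} (hx : 0 ≤ x) (hy : 0 ≤ y) (ha : 0 ≤ a)
    (hM : 0 ≤ M) (hb : 0 ≤ b) (hsum : x + y + a + M + b ≤ 1)
    (h1 : 9999 / 10000 < x ^ (12 / 25 : ℝ) + y ^ (12 / 25 : ℝ))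
    (h2 : 9999 / 10000 < a ^ (12 / 25 : ℝ) + M ^ (12 / 25 : ℝ))
    (h3 : 9999 / 10000 < M ^ (12 / 25 : ℝ) + b ^ (12 / 25 : ℝ)) : False := by
  have ta := rpow_le_tangent ha (u := 0.915) (by norm_num)
  have tb := rpow_le_tangent hb (u := 0.915) (by norm_num)
  have tM := rpow_le_tangent hM (u := 0.965) (by norm_num)
  have tx := rpow_le_tangent hx (u := 0.944) (by norm_num)
  have ty := rpow_le_tangent hy (u := 0.944) (by norm_num)
  norm_num at ta tb tM tx ty
  linarith

/-! ### Balanced root-to-leaf paths -/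

/-- The size of the largest left subtree of a path (`0` if there is none). -/
def LeafPath.maxLeft : {T : OrderedTree} → LeafPath T → ℕ
  | _, .leaf => 0
  | .node _ ch, .step i π => max ((Finset.univ.filter (· < i)).sup fun j => (ch j).size) π.maxLeft

/-- The size of the largest right subtree of a path (`0` if there is none). -/
def LeafPath.maxRight : {T : OrderedTree} → LeafPath T → ℕ
  | _, .leaf => 0
  | .node _ ch, .step i π => max ((Finset.univ.filter (i < ·)).sup fun j => (ch j).size) π.maxRight

theorem size_pos : (T : OrderedTree) → 0 < T.size
  | node _ _ => by simp [size]

theorem size_child_lt {d : ℕ} (ch : Fin d → OrderedTree) (i : Fin d) :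
    (ch i).size < (node d ch).size := by
  have := Finset.single_le_sum (f := fun i => (ch i).size) (fun _ _ => Nat.zero_le _)
    (Finset.mem_univ i)
  simp only [size] at *
  omega

theorem sum_size_lt {d : ℕ} (ch : Fin d → OrderedTree) (s : Finset (Fin d)) :
    ∑ i ∈ s, (ch i).size < (node d ch).size := by
  have := Finset.sum_le_sum_of_subset (f := fun i => (ch i).size) (Finset.subset_univ s)
  simp only [size] at *
  omega

/-- Always take the first child. This path and its mirror image are the test paths whose failure
drives the descent. -/
theorem exists_leftmost_path (T : OrderedTree) :
    ∃ π : LeafPath T, π.maxLeft = 0 ∧ π.maxRight ≤ T.size := by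
  induction T with
  | node d ch ih =>
    rcases d with _ | d
    · exact ⟨.leaf, rfl, Nat.zero_le _⟩
    · obtain ⟨π, h1, h2⟩ := ih 0
      refine ⟨.step 0 π, by simp [LeafPath.maxLeft, h1], ?_⟩
      simp only [LeafPath.maxRight, max_le_iff, Finset.sup_le_iff]
      exact ⟨fun j _ => (size_child_lt ch j).le, h2.trans (size_child_lt ch 0).le⟩

theorem exists_rightmost_path (T : OrderedTree) :
    ∃ π : LeafPath T, π.maxLeft ≤ T.size ∧ π.maxRight = 0 := by
  induction T with
  | node d ch ih =>
    rcases d with _ | d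
    · exact ⟨.leaf, Nat.zero_le _, rfl⟩
    · obtain ⟨π, h1, h2⟩ := ih (Fin.last d)
      refine ⟨.step (Fin.last d) π, ?_, ?_⟩
      · simp only [LeafPath.maxLeft, max_le_iff, Finset.sup_le_iff]
        exact ⟨fun j _ => (size_child_lt ch j).le, h1.trans (size_child_lt ch _).le⟩
      · simp [LeafPath.maxRight, h2, Fin.le_last]

/-- A monotone measure `f` of the sizes of subtrees and a bound `K` such that at most few disjoint
pairs among subtrees of total size `n` can exceed the bound. -/
structure PairBound (f : ℕ → ℝ) (K : ℝ) (n : ℕ) : Prop where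
  mono : Monotone f
  -- `a` and `b` are the maxima met so far, `L` and `R` two subtrees inside the part of size `s`,
  -- and `g`, `s` the pair carried along.
  three : ∀ a R b L g s, L + R ≤ s → a + b + g + s ≤ n →
    K < f a + f R → K < f L + f b → K < f g + f s → False
  -- `M` belongs to two of the three pairs.
  star : ∀ x y a M b, x + y + a + M + b ≤ n →
    K < f x + f y → K < f a + f M → K < f M + f b → False

/-- The invariant of the descent along a balanced path: `a` and `b` are the sizes of the largest
left and right subtrees met so far and `t` is the size of the remaining subtree. -/
def DescentInvariant (f : ℕ → ℝ) (K : ℝ) (n a b t : ℕ) : Prop :=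
  ∃ g, (∃ s, t ≤ s ∧ a + b + g + s ≤ n ∧ K < f g + f s) ∨
    (a + b + g + t ≤ n ∧ (K < f b + f g ∨ K < f a + f g))

section Descent

variable {d : ℕ} (ch : Fin d → OrderedTree)

/-- The size of the largest sibling before the `i`-th child, or `a` if that is larger. -/
def maxBefore (a : ℕ) (i : Fin d) : ℕ :=
  max a ((Finset.univ.filter (· < i)).sup fun j => (ch j).size)

/-- The size of the largest sibling after the `i`-th child, or `a` if that is larger. -/
def maxAfter (a : ℕ) (i : Fin d) : ℕ :=
  max a ((Finset.univ.filter (i < ·)).sup fun j => (ch j).size)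

variable {ch}

theorem maxBefore_eq (a : ℕ) (i : Fin d) :
    maxBefore ch a i = a ∨ ∃ x < i, maxBefore ch a i = (ch x).size := by
  unfold maxBefore
  rcases max_choice a ((Finset.univ.filter (· < i)).sup fun j => (ch j).size) with h | h
  · exact Or.inl h
  · rcases (Finset.univ.filter (· < i)).eq_empty_or_nonempty with he | he
    · simp [he]
    · obtain ⟨x, hx, hxe⟩ := Finset.exists_mem_eq_sup _ he (fun j => (ch j).size)
      exact Or.inr ⟨x, by simpa using hx, by rw [h, hxe]⟩

theorem maxAfter_eq (a : ℕ) (i : Fin d) :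
    maxAfter ch a i = a ∨ ∃ x, i < x ∧ maxAfter ch a i = (ch x).size := by
  unfold maxAfter
  rcases max_choice a ((Finset.univ.filter (i < ·)).sup fun j => (ch j).size) with h | h
  · exact Or.inl h
  · rcases (Finset.univ.filter (i < ·)).eq_empty_or_nonempty with he | he
    · simp [he]
    · obtain ⟨x, hx, hxe⟩ := Finset.exists_mem_eq_sup _ he (fun j => (ch j).size)
      exact Or.inr ⟨x, by simpa using hx, by rw [h, hxe]⟩

theorem le_maxBefore (a : ℕ) (i : Fin d) : a ≤ maxBefore ch a i := le_max_left _ _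

theorem le_maxAfter (a : ℕ) (i : Fin d) : a ≤ maxAfter ch a i := le_max_left _ _

theorem size_le_maxBefore (a : ℕ) {x i : Fin d} (h : x < i) : (ch x).size ≤ maxBefore ch a i :=
  (Finset.le_sup (f := fun j => (ch j).size) (by simpa using h)).trans (le_max_right _ _)

theorem size_le_maxAfter (a : ℕ) {x i : Fin d} (h : i < x) : (ch x).size ≤ maxAfter ch a i :=
  (Finset.le_sup (f := fun j => (ch j).size) (by simpa using h)).trans (le_max_right _ _)

theorem maxBefore_mono (a : ℕ) {x i : Fin d} (h : x ≤ i) :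
    maxBefore ch a x ≤ maxBefore ch a i := by
  rcases maxBefore_eq (ch := ch) a x with h1 | ⟨y, hy, h1⟩ <;> rw [h1]
  · exact le_maxBefore a i
  · exact size_le_maxBefore a (hy.trans_le h)

theorem maxAfter_anti (a : ℕ) {x i : Fin d} (h : i ≤ x) :
    maxAfter ch a x ≤ maxAfter ch a i := by
  rcases maxAfter_eq (ch := ch) a x with h1 | ⟨y, hy, h1⟩ <;> rw [h1]
  · exact le_maxAfter a i
  · exact size_le_maxAfter a (h.trans_lt hy)

theorem size_add_size_lt (ch : Fin d → OrderedTree) {i j : Fin d} (h : i < j) :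
    (ch i).size + (ch j).size < (node d ch).size := by
  have := sum_size_lt ch {i, j}
  rwa [Finset.sum_pair h.ne] at this

theorem size_add_three_lt (ch : Fin d → OrderedTree) {i j k : Fin d} (h : i < j) (h' : j < k) :
    (ch i).size + (ch j).size + (ch k).size < (node d ch).size := by
  have := sum_size_lt ch {i, j, k}
  rw [Finset.sum_insert (by simp [h.ne, (h.trans h').ne]), Finset.sum_pair h'.ne] at this
  omega

theorem size_add_four_lt (ch : Fin d → OrderedTree) {i j k l : Fin d} (h : i < j) (h' : j < k)
    (h'' : k < l) :
    (ch i).size + (ch j).size + (ch k).size + (ch l).size < (node d ch).size := by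
  have := sum_size_lt ch {i, j, k, l}
  rw [Finset.sum_insert (by simp [h.ne, (h.trans h').ne, (h.trans (h'.trans h'')).ne]),
    Finset.sum_insert (by simp [h'.ne, (h'.trans h'').ne]), Finset.sum_pair h''.ne] at this
  omega

variable {f : ℕ → ℝ} {K : ℝ} {n a b : ℕ}

/-- `hbad` is the failure of the path through `y` that then keeps right. Its right maximum is the
new `g`. By `hK` its left maximum is neither `a` nor a sibling before `i`, so it is child `i`
itself, giving the pair `g`, `s`, or at most the new right maximum, giving a pair with `b`. -/
theorem descentInvariant_of_maxAfter (hf : Monotone f) (hn : a + b + (node d ch).size ≤ n)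
    {i y : Fin d} (hy : i < y) (hb : maxAfter ch b i = (ch y).size)
    (hK : f (maxBefore ch a i) + f (maxAfter ch b i) ≤ K)
    (hbad : K < f (max (maxBefore ch a y) (ch y).size) + f (maxAfter ch b y)) :
    DescentInvariant f K n (maxBefore ch a i) (maxAfter ch b i) (ch i).size := by
  have hsum : maxBefore ch a i + maxAfter ch b i + maxAfter ch b y + (ch i).size ≤ n := by
    rcases maxBefore_eq (ch := ch) a i with h1 | ⟨x, hx, h1⟩ <;>
    rcases maxAfter_eq (ch := ch) b y with h2 | ⟨z, hz, h2⟩ <;> rw [h1, h2, hb]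
    · have := size_add_size_lt ch hy
      omega
    · have := size_add_three_lt ch hy hz
      omega
    · have := size_add_three_lt ch hx hy
      omega
    · have := size_add_four_lt ch hx hy hz
      omega
  have hg := hf (maxAfter_anti (ch := ch) b hy.le)
  refine ⟨maxAfter ch b y, ?_⟩
  rcases max_choice (maxBefore ch a y) (ch y).size with h | h <;> rw [h] at hbad
  · rcases maxBefore_eq (ch := ch) a y with h1 | ⟨z, hz, h1⟩ <;> rw [h1] at hbad
    · have := hf (le_maxBefore (ch := ch) a i)
      linarith
    · rcases lt_trichotomy z i with hzi | rfl | hzi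
      · have := hf (size_le_maxBefore (ch := ch) a hzi)
        linarith
      · exact Or.inl ⟨_, le_rfl, hsum, by linarith⟩
      · have := hf (size_le_maxAfter (ch := ch) b hzi)
        exact Or.inr ⟨hsum, Or.inl (by linarith)⟩
  · rw [← hb] at hbad
    exact Or.inr ⟨hsum, Or.inl hbad⟩

theorem descentInvariant_of_maxBefore (hf : Monotone f) (hn : a + b + (node d ch).size ≤ n)
    {i y : Fin d} (hy : y < i) (ha : maxBefore ch a i = (ch y).size)
    (hK : f (maxBefore ch a i) + f (maxAfter ch b i) ≤ K)
    (hbad : K < f (maxBefore ch a y) + f (max (maxAfter ch b y) (ch y).size)) :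
    DescentInvariant f K n (maxBefore ch a i) (maxAfter ch b i) (ch i).size := by
  have hsum : maxBefore ch a i + maxAfter ch b i + maxBefore ch a y + (ch i).size ≤ n := by
    rcases maxAfter_eq (ch := ch) b i with h1 | ⟨x, hx, h1⟩ <;>
    rcases maxBefore_eq (ch := ch) a y with h2 | ⟨z, hz, h2⟩ <;> rw [h1, h2, ha]
    · have := size_add_size_lt ch hy
      omega
    · have := size_add_three_lt ch hz hy
      omega
    · have := size_add_three_lt ch hy hx
      omega
    · have := size_add_four_lt ch hz hy hx
      omega
  have hg := hf (maxBefore_mono (ch := ch) a hy.le)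
  refine ⟨maxBefore ch a y, ?_⟩
  rcases max_choice (maxAfter ch b y) (ch y).size with h | h <;> rw [h] at hbad
  · rcases maxAfter_eq (ch := ch) b y with h1 | ⟨z, hz, h1⟩ <;> rw [h1] at hbad
    · have := hf (le_maxAfter (ch := ch) b i)
      linarith
    · rcases lt_trichotomy z i with hzi | rfl | hzi
      · have := hf (size_le_maxBefore (ch := ch) a hzi)
        exact Or.inr ⟨hsum, Or.inr (by linarith)⟩
      · exact Or.inl ⟨_, le_rfl, hsum, by linarith⟩
      · have := hf (size_le_maxAfter (ch := ch) b hzi)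
        linarith
  · rw [← ha] at hbad
    exact Or.inr ⟨hsum, Or.inr (by linarith)⟩

theorem DescentInvariant.add_le {t : ℕ} (h : DescentInvariant f K n a b t) : a + b + t ≤ n := by
  obtain ⟨g, ⟨s, h1, h2, -⟩ | ⟨h1, -⟩⟩ := h <;> omega

theorem DescentInvariant.mono {t t' : ℕ} (h : DescentInvariant f K n a b t) (ht : t' ≤ t) :
    DescentInvariant f K n a b t' := by
  obtain ⟨g, ⟨s, h1, h2, h3⟩ | ⟨h1, h2⟩⟩ := h
  · exact ⟨g, Or.inl ⟨s, ht.trans h1, h2, h3⟩⟩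
  · exact ⟨g, Or.inr ⟨by omega, h2⟩⟩

/-- The pair stored in the invariant is the third large one: `three` applies if it avoids `a` and
`b`, and `star` if it shares one of them, which then plays the part of `M`. -/
theorem DescentInvariant.not_two_large (hf : PairBound f K n) {t L R : ℕ}
    (h : DescentInvariant f K n a b t) (ht : L + R ≤ t) (hR : K < f a + f R)
    (hL : K < f L + f b) : False := by
  obtain ⟨g, ⟨s, h1, h2, h3⟩ | ⟨h1, h2 | h2⟩⟩ := h
  · exact hf.three a R b L g s (ht.trans h1) h2 hR hL h3
  · exact hf.star a R L b g (by omega) hR hL h2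
  · exact hf.star L b R a g (by omega) hL (by linarith) h2

theorem exists_balanced_path_of_invariant (hf : PairBound f K n) (T : OrderedTree) :
    ∀ a b, f a + f b ≤ K → DescentInvariant f K n a b T.size →
      ∃ π : LeafPath T, f (max a π.maxLeft) + f (max b π.maxRight) ≤ K := by
  induction T with
  | node d ch ih =>
    intro a b hab hinv
    by_contra hbad
    push Not at hbad
    have hstep : ∀ i (π : LeafPath (ch i)), K < f (max (maxBefore ch a i) π.maxLeft) +
        f (max (maxAfter ch b i) π.maxRight) := fun i π => by
      have := hbad (.step i π)
      simpa only [LeafPath.maxLeft, LeafPath.maxRight, maxBefore, maxAfter, max_assoc] using this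
    have hleft : ∀ i, K < f (maxBefore ch a i) + f (max (maxAfter ch b i) (ch i).size) := by
      intro i
      obtain ⟨π, h1, h2⟩ := exists_leftmost_path (ch i)
      have h := hstep i π
      rw [h1, Nat.max_zero] at h
      linarith [hf.mono (max_le_max_left (maxAfter ch b i) h2)]
    have hright : ∀ i, K < f (max (maxBefore ch a i) (ch i).size) + f (maxAfter ch b i) := by
      intro i
      obtain ⟨π, h1, h2⟩ := exists_rightmost_path (ch i)
      have h := hstep i π
      rw [h2, Nat.max_zero] at h
      linarith [hf.mono (max_le_max_left (maxBefore ch a i) h1)]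
    -- Any child that keeps the maxima balanced will do: once the invariant is restored, induction
    -- yields a path that contradicts `hstep`.
    by_cases hs : ∃ i, f (maxBefore ch a i) + f (maxAfter ch b i) ≤ K
    · obtain ⟨i, hi⟩ := hs
      have hinv' : DescentInvariant f K n (maxBefore ch a i) (maxAfter ch b i) (ch i).size := by
        rcases maxAfter_eq (ch := ch) b i with h1 | ⟨y, hy, h1⟩
        · rcases maxBefore_eq (ch := ch) a i with h2 | ⟨y, hy, h2⟩
          · rw [h1, h2]
            exact hinv.mono (size_child_lt ch i).le
          · exact descentInvariant_of_maxBefore hf.mono hinv.add_le hy h2 hi (hleft y)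
        · exact descentInvariant_of_maxAfter hf.mono hinv.add_le hy h1 hi (hright y)
      obtain ⟨π, hπ⟩ := ih i _ _ hi hinv'
      exact (hstep i π).not_ge hπ
    -- No child keeps the balance. At the first child the left maximum is still `a`, so the right
    -- one is a child `m`; at the last child, symmetrically, the left one is a child `k`. If k ≠ m,
    -- two large pairs are disjoint. If k = m, imbalance at child `k` itself gives another pair.
    · push Not at hs
      rcases d with _ | d
      · have := hbad .leaf
        simp only [LeafPath.maxLeft, LeafPath.maxRight, Nat.max_zero] at this
        linarith
      have two : ∀ x y, x ≠ y → K < f a + f (ch y).size → K < f (ch x).size + f b → False := by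
        intro x y hxy h1 h2
        refine hinv.not_two_large hf ?_ h1 h2
        rcases lt_or_gt_of_ne hxy with h | h
        · exact (size_add_size_lt ch h).le
        · rw [add_comm]
          exact (size_add_size_lt ch h).le
      have h0 := hs 0
      rcases maxBefore_eq (ch := ch) a 0 with h1 | ⟨y, hy, -⟩
      swap
      · exact absurd hy (Fin.not_lt_zero y)
      rw [h1] at h0
      rcases maxAfter_eq (ch := ch) b 0 with h2 | ⟨m, -, h2⟩ <;> rw [h2] at h0
      · linarith
      have hl := hs (Fin.last d)
      rcases maxAfter_eq (ch := ch) b (Fin.last d) with h1 | ⟨y, hy, -⟩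
      swap
      · exact absurd hy (Fin.le_last y).not_gt
      rw [h1] at hl
      rcases maxBefore_eq (ch := ch) a (Fin.last d) with h2 | ⟨k, -, h2⟩ <;> rw [h2] at hl
      · linarith
      by_cases hkm : k = m
      swap
      · exact two k m hkm h0 hl
      subst hkm
      have hk := hs k
      rcases maxBefore_eq (ch := ch) a k with h1 | ⟨x, hx, h1⟩ <;>
      rcases maxAfter_eq (ch := ch) b k with h2 | ⟨y, hy, h2⟩ <;> rw [h1, h2] at hk
      · linarith
      · exact two k y hy.ne hk hl
      · exact two x k hx.ne h0 hk
      · have := size_add_three_lt ch hx hy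
        have := hinv.add_le
        exact hf.star (ch x).size (ch y).size a (ch k).size b (by omega) hk h0 hl

end Descent

theorem pairBound_rpow {n : ℕ} (hn : 0 < n) :
    PairBound (fun m => ((m : ℝ) / n) ^ (12 / 25 : ℝ)) (9999 / 10000) n := by
  have hn' : (0 : ℝ) < n := by exact_mod_cast hn
  refine ⟨?_, ?_, ?_⟩
  · intro m m' h
    have : (m : ℝ) ≤ m' := by exact_mod_cast h
    dsimp only
    gcongr
  · intro a R b L g s hs hsum h1 h2 h3
    refine no_three_large_power_sums (by positivity) (by positivity) (by positivity)
      (by positivity) (by positivity) ?_ ?_ h1 h2 h3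
    · rw [← add_div]
      gcongr
      exact_mod_cast hs
    · rw [← add_div, ← add_div, ← add_div, div_le_one hn']
      exact_mod_cast hsum
  · intro x y a M b hsum h1 h2 h3
    refine no_three_large_power_sums' (by positivity) (by positivity) (by positivity)
      (by positivity) (by positivity) ?_ h1 h2 h3
    rw [← add_div, ← add_div, ← add_div, ← add_div, div_le_one hn']
    exact_mod_cast hsum

/-- Every ordered tree has a root-to-leaf path whose largest left and right subtrees are balanced
in the sense that the sum of the `12 / 25`-th powers of their sizes is bounded away from that of
the tree. -/
theorem exists_balanced_path (T : OrderedTree) :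
    ∃ π : LeafPath T, (π.maxLeft : ℝ) ^ (12 / 25 : ℝ) + (π.maxRight : ℝ) ^ (12 / 25 : ℝ) ≤
      9999 / 10000 * (T.size : ℝ) ^ (12 / 25 : ℝ) := by
  have hn := T.size_pos
  have hn' : (0 : ℝ) < T.size := by exact_mod_cast hn
  -- At the root the stored pair is `0` and the whole tree, with power sum 0 + 1 > 0.9999.
  obtain ⟨π, hπ⟩ := exists_balanced_path_of_invariant (pairBound_rpow hn) T 0 0
    (by norm_num) ⟨0, Or.inl ⟨T.size, le_rfl, by omega, by
      simp only [div_self hn'.ne', Nat.cast_zero, zero_div]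
      norm_num⟩⟩
  refine ⟨π, ?_⟩
  simp only [Nat.zero_max] at hπ
  rw [Real.div_rpow (by positivity) hn'.le, Real.div_rpow (by positivity) hn'.le, ← add_div,
    div_le_iff₀ (by positivity)] at hπ
  exact hπ

/-! ### Tidy drawings are strictly upward GLR-drawings -/

open Vertex

namespace StraightLineDrawing

/-- A recursive certificate for a strictly upward GLR-drawing: every node is above its
descendants, the drawings of the subtrees at two children of a node are in disjoint rows, the
upper one is on the correct side of the edge to the root of the lower one, and every subtree has a
vertical path that separates its left from its right subtrees. -/
def IsTidy : {T : OrderedTree} → StraightLineDrawing T → Prop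
  | node d ch, Γ =>
    (∀ i (v : Vertex (ch i)), (Γ (child i v)).2 < (Γ root).2) ∧
    (∀ i j, i < j →
      ((∀ v w, (Γ (child j w)).2 < (Γ (child i v)).2) ∧
        ∀ v, 0 < cross (Γ (child i v) - Γ root) (Γ (child j root) - Γ root)) ∨
      ((∀ v w, (Γ (child i v)).2 < (Γ (child j w)).2) ∧
        ∀ w, 0 < cross (Γ (child i root) - Γ root) (Γ (child j w) - Γ root))) ∧
    (∃ (π : LeafPath (node d ch)) (a : ℤ), Γ.IsVerticalPath π a ∧ Γ.IsSeparatedBy π a) ∧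
    ∀ i, IsTidy (T := ch i) fun v => Γ (child i v)

variable {T : OrderedTree} {Γ : StraightLineDrawing T}

theorem IsTidy.lt_root (h : Γ.IsTidy) {v : Vertex T} (hv : v ≠ root) : (Γ v).2 < (Γ root).2 := by
  cases T with
  | node d ch =>
    cases v with
    | root => exact absurd rfl hv
    | child i v => exact h.1 i v

theorem IsTidy.le_root (h : Γ.IsTidy) (v : Vertex T) : (Γ v).2 ≤ (Γ root).2 := by
  by_cases hv : v = root
  · rw [hv]
  · exact (h.lt_root hv).le

theorem IsTidy.isStrictlyUpward (h : Γ.IsTidy) : Γ.IsStrictlyUpward := by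
  induction T with
  | node d ch ih =>
    intro v
    cases v with
    | root => exact fun w hw => h.lt_root hw
    | child i v => exact ih i (h.2.2.2 i) v

theorem IsTidy.exists_path (h : Γ.IsTidy) (v : Vertex T) : ∃ (π : LeafPath v.subtree) (a : ℤ),
    (Γ.induced v).IsVerticalPath π a ∧ (Γ.induced v).IsSeparatedBy π a := by
  induction T with
  | node d ch ih =>
    cases v with
    | root => exact h.2.2.1
    | child i v => exact ih i (h.2.2.2 i) v

theorem IsTidy.kid_lt (h : Γ.IsTidy) (v : Vertex T) (i : Fin v.arity) :
    (Γ (v.kid i)).2 < (Γ v).2 := by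
  induction T with
  | node d ch ih =>
    cases v with
    | root => exact h.1 i root
    | child j v => exact ih j (h.2.2.2 j) v i

theorem IsTidy.cross_kid_pos (h : Γ.IsTidy) (v : Vertex T) (i j : Fin v.arity) (hij : i < j) :
    0 < cross (Γ (v.kid i) - Γ v) (Γ (v.kid j) - Γ v) := by
  induction T with
  | node d ch ih =>
    cases v with
    | root =>
      rcases h.2.1 i j hij with h | h
      · exact h.2 root
      · exact h.2 root
    | child k v => exact ih k (h.2.2.2 k) v i j hij

/-- `key` is the second coordinate of the linear relation between three plane vectors. If neither
remaining cross product were positive, its first term would be positive and the others nonnegative.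
-/
theorem counterClockwise_of_cross_pos {w a b : ℤ × ℤ} (hw : 0 < w.2) (ha : a.2 < 0) (hb : b.2 < 0)
    (hab : 0 < cross a b) : CounterClockwise w a b := by
  by_cases h1 : 0 < cross w a
  · exact Or.inl ⟨h1, hab⟩
  by_cases h2 : 0 < cross b w
  · exact Or.inr (Or.inl ⟨hab, h2⟩)
  exfalso
  have key : cross a b * w.2 + cross b w * a.2 + cross w a * b.2 = 0 := by
    simp only [cross]
    ring
  have := mul_pos hab hw
  have := mul_nonneg_of_nonpos_of_nonpos (not_lt.1 h2) ha.le
  have := mul_nonneg_of_nonpos_of_nonpos (not_lt.1 h1) hb.le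
  linarith

theorem IsTidy.isOrderPreserving (h : Γ.IsTidy) : Γ.IsOrderPreserving := by
  refine ⟨fun i j hij => ?_, fun u k i j hij => ?_⟩
  · refine counterClockwise_of_cross_pos one_pos ?_ ?_ (h.cross_kid_pos root i j hij) <;>
    simpa using h.kid_lt _ _
  · refine counterClockwise_of_cross_pos ?_ ?_ ?_ (h.cross_kid_pos (u.kid k) i j hij) <;>
    simpa using h.kid_lt _ _

theorem IsTidy.injective (h : Γ.IsTidy) : Function.Injective Γ := by
  induction T with
  | node d ch ih =>
    have hne : ∀ i j v w, i < j → Γ (child i v) ≠ Γ (child j w) := by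
      intro i j v w hij he
      rcases h.2.1 i j hij with h | h
      · exact (h.1 v w).ne (by rw [he])
      · exact (h.1 v w).ne (by rw [he])
    intro v w hvw
    cases v with
    | root =>
      cases w with
      | root => rfl
      | child j w => exact absurd (congrArg Prod.snd hvw) (h.1 j w).ne'
    | child i v =>
      cases w with
      | root => exact absurd (congrArg Prod.snd hvw) (h.1 i v).ne
      | child j w =>
        rcases lt_trichotomy i j with hij | rfl | hij
        · exact absurd hvw (hne i j v w hij)
        · rw [ih i (h.2.2.2 i) hvw]
        · exact absurd hvw.symm (hne j i w v hij)

theorem mem_segment_gridPoint {P Q : ℤ × ℤ} {X : ℝ × ℝ}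
    (h : X ∈ segment ℝ (gridPoint P) (gridPoint Q)) :
    ∃ a b : ℝ, 0 ≤ a ∧ 0 ≤ b ∧ a + b = 1 ∧ X.1 = a * P.1 + b * Q.1 ∧ X.2 = a * P.2 + b * Q.2 := by
  obtain ⟨a, b, ha, hb, hab, rfl⟩ := h
  exact ⟨a, b, ha, hb, hab, by simp [gridPoint], by simp [gridPoint]⟩

theorem snd_le_of_mem_segment {P Q : ℤ × ℤ} {X : ℝ × ℝ} {y : ℤ}
    (h : X ∈ segment ℝ (gridPoint P) (gridPoint Q)) (hP : P.2 ≤ y) (hQ : Q.2 ≤ y) : X.2 ≤ y := by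
  obtain ⟨a, b, ha, hb, hab, -, h2⟩ := mem_segment_gridPoint h
  have hP' : (P.2 : ℝ) ≤ y := by exact_mod_cast hP
  have hQ' : (Q.2 : ℝ) ≤ y := by exact_mod_cast hQ
  rw [h2]
  calc a * P.2 + b * Q.2 ≤ a * y + b * y := by gcongr
    _ = y := by rw [← add_mul, hab, one_mul]

theorem le_snd_of_mem_segment {P Q : ℤ × ℤ} {X : ℝ × ℝ} {y : ℤ}
    (h : X ∈ segment ℝ (gridPoint P) (gridPoint Q)) (hP : y ≤ P.2) (hQ : y ≤ Q.2) : y ≤ X.2 := by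
  obtain ⟨a, b, ha, hb, hab, -, h2⟩ := mem_segment_gridPoint h
  have hP' : (y : ℝ) ≤ P.2 := by exact_mod_cast hP
  have hQ' : (y : ℝ) ≤ Q.2 := by exact_mod_cast hQ
  rw [h2]
  calc (y : ℝ) = a * y + b * y := by rw [← add_mul, hab, one_mul]
    _ ≤ a * P.2 + b * Q.2 := by gcongr

/-- A point of a downward edge in the row of its upper end is this end. -/
theorem eq_of_mem_segment_of_snd_eq {P Q : ℤ × ℤ} {X : ℝ × ℝ} (hPQ : Q.2 < P.2)
    (h : X ∈ segment ℝ (gridPoint P) (gridPoint Q)) (hX : (P.2 : ℝ) ≤ X.2) : X = gridPoint P := by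
  obtain ⟨a, b, ha, hb, hab, h1, h2⟩ := mem_segment_gridPoint h
  have hPQ' : (Q.2 : ℝ) < P.2 := by exact_mod_cast hPQ
  obtain rfl : a = 1 - b := by linarith
  have : b = 0 := by
    by_contra hne
    have : 0 < b := lt_of_le_of_ne hb (Ne.symm hne)
    nlinarith
  subst this
  ext <;> simp [gridPoint, h1, h2]

/-- Points of a segment are on the same side of a line through a point as its ends. -/
theorem ne_of_mem_segment_of_cross_pos {P Q R S : ℤ × ℤ} {X Y : ℝ × ℝ}
    (hX : X ∈ segment ℝ (gridPoint P) (gridPoint R))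
    (hY : Y ∈ segment ℝ (gridPoint Q) (gridPoint S))
    (hcross : (0 < cross (R - P) (Q - P) ∧ 0 < cross (R - P) (S - P)) ∨
      (0 < cross (Q - P) (R - P) ∧ 0 < cross (S - P) (R - P))) : X ≠ Y := by
  rintro rfl
  obtain ⟨a, b, ha, hb, hab, h1, h2⟩ := mem_segment_gridPoint hX
  obtain ⟨a', b', ha', hb', hab', h1', h2'⟩ := mem_segment_gridPoint hY
  obtain rfl : a = 1 - b := by linarith
  obtain rfl : a' = 1 - b' := by linarith
  have key : (1 - b') * ((R.1 - P.1) * (Q.2 - P.2) - (R.2 - P.2) * (Q.1 - P.1)) +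
      b' * ((R.1 - P.1) * (S.2 - P.2) - (R.2 - P.2) * (S.1 - P.1)) = (0 : ℝ) := by
    linear_combination (R.1 - P.1 : ℝ) * (h2 - h2') - (R.2 - P.2 : ℝ) * (h1 - h1')
  simp only [cross, Prod.fst_sub, Prod.snd_sub] at hcross
  rcases hcross with ⟨h3, h4⟩ | ⟨h3, h4⟩
  · have h3' : (0 : ℝ) < (R.1 - P.1) * (Q.2 - P.2) - (R.2 - P.2) * (Q.1 - P.1) := by
      exact_mod_cast h3
    have h4' : (0 : ℝ) < (R.1 - P.1) * (S.2 - P.2) - (R.2 - P.2) * (S.1 - P.1) := by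
      exact_mod_cast h4
    rcases hb'.eq_or_lt with rfl | hb''
    · linarith
    · nlinarith [mul_pos hb'' h4', mul_nonneg ha' h3'.le]
  · have h3' : (0 : ℝ) < (Q.1 - P.1) * (R.2 - P.2) - (Q.2 - P.2) * (R.1 - P.1) := by
      exact_mod_cast h3
    have h4' : (0 : ℝ) < (S.1 - P.1) * (R.2 - P.2) - (S.2 - P.2) * (R.1 - P.1) := by
      exact_mod_cast h4
    rcases hb'.eq_or_lt with rfl | hb''
    · linarith
    · nlinarith [mul_pos hb'' h4', mul_nonneg ha' h3'.le]

theorem eq_of_mem_segments_of_cross_ne_zero {P Q R : ℤ × ℤ} {X : ℝ × ℝ}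
    (hQ : X ∈ segment ℝ (gridPoint P) (gridPoint Q)) (hR : X ∈ segment ℝ (gridPoint P) (gridPoint R))
    (hcross : cross (Q - P) (R - P) ≠ 0) : X = gridPoint P := by
  obtain ⟨a, b, ha, hb, hab, h1, h2⟩ := mem_segment_gridPoint hQ
  obtain ⟨a', b', ha', hb', hab', h1', h2'⟩ := mem_segment_gridPoint hR
  obtain rfl : a = 1 - b := by linarith
  obtain rfl : a' = 1 - b' := by linarith
  have hc : ((Q.1 - P.1) * (R.2 - P.2) - (Q.2 - P.2) * (R.1 - P.1) : ℝ) ≠ 0 := by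
    simp only [cross, Prod.fst_sub, Prod.snd_sub] at hcross
    exact_mod_cast hcross
  have key : b * ((Q.1 - P.1) * (R.2 - P.2) - (Q.2 - P.2) * (R.1 - P.1)) = (0 : ℝ) := by
    linear_combination (R.1 - P.1 : ℝ) * (h2 - h2') - (R.2 - P.2 : ℝ) * (h1 - h1')
  rcases mul_eq_zero.1 key with rfl | h
  · ext <;> simp [gridPoint, h1, h2]
  · exact absurd h hc

section Node

variable {d : ℕ} {ch : Fin d → OrderedTree} {Γ : StraightLineDrawing (node d ch)}

theorem IsTidy.edge_root_inter_edge_root (h : Γ.IsTidy) {i j : Fin d} (hij : i ≠ j) :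
    Γ.edge root i ∩ Γ.edge root j ⊆ {gridPoint (Γ root)} := by
  rintro X ⟨h1, h2⟩
  rcases lt_or_gt_of_ne hij with hij | hij
  · exact eq_of_mem_segments_of_cross_ne_zero h1 h2 (h.cross_kid_pos root i j hij).ne'
  · exact eq_of_mem_segments_of_cross_ne_zero h2 h1 (h.cross_kid_pos root j i hij).ne'

/-- If child `i` is the upper one, the edge to it ends above the whole subtree of `k`. Otherwise
that subtree lies strictly on one side of the line through this edge. -/
theorem IsTidy.edge_root_inter_edge_child (h : Γ.IsTidy) {i k : Fin d} (hik : i ≠ k)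
    (w : Vertex (ch k)) (m : Fin w.arity) :
    Γ.edge root i ∩ Γ.edge (child k w) m = ∅ := by
  rw [Set.eq_empty_iff_forall_notMem]
  rintro X ⟨h1, h2⟩
  have above : (∀ v w, (Γ (child k w)).2 < (Γ (child i v)).2) → False := fun hlt => by
    have hX := snd_le_of_mem_segment h2 (y := (Γ (child i root)).2 - 1)
      (Int.le_sub_one_of_lt (hlt root w)) (Int.le_sub_one_of_lt (hlt root (w.kid m)))
    have hX' := le_snd_of_mem_segment h1 (y := (Γ (child i root)).2) (h.1 i root).le le_rfl
    push_cast at hX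
    linarith
  rcases lt_or_gt_of_ne hik with hik | hik
  · rcases h.2.1 i k hik with hc | hc
    · exact above hc.1
    · exact ne_of_mem_segment_of_cross_pos h1 h2 (Or.inl ⟨hc.2 w, hc.2 (w.kid m)⟩) rfl
  · rcases h.2.1 k i hik with hc | hc
    · exact ne_of_mem_segment_of_cross_pos h1 h2 (Or.inr ⟨hc.2 w, hc.2 (w.kid m)⟩) rfl
    · exact above fun v w => hc.1 w v

theorem IsTidy.edge_root_inter_edge_same_child (h : Γ.IsTidy) (i : Fin d)
    (w : Vertex (ch i)) (m : Fin w.arity) :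
    Γ.edge root i ∩ Γ.edge (child i w) m ⊆ {X | w = root ∧ X = gridPoint (Γ (child i root))} := by
  rintro X ⟨h1, h2⟩
  have hi : IsTidy fun v => Γ (child i v) := h.2.2.2 i
  have hX := le_snd_of_mem_segment h1 (y := (Γ (child i root)).2) (h.1 i root).le le_rfl
  by_cases hw : w = root
  · subst hw
    exact ⟨rfl, eq_of_mem_segment_of_snd_eq (hi.kid_lt root m) h2 hX⟩
  · have hX' := snd_le_of_mem_segment h2 (y := (Γ (child i root)).2 - 1)
      (Int.le_sub_one_of_lt (hi.lt_root hw))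
      (Int.le_sub_one_of_lt ((hi.kid_lt w m).trans (hi.lt_root hw)))
    push_cast at hX'
    linarith

theorem IsTidy.edge_child_inter_edge_child (h : Γ.IsTidy) {i k : Fin d} (hik : i ≠ k)
    (v : Vertex (ch i)) (j : Fin v.arity) (w : Vertex (ch k)) (m : Fin w.arity) :
    Γ.edge (child i v) j ∩ Γ.edge (child k w) m = ∅ := by
  have key : ∀ {i k : Fin d} (v : Vertex (ch i)) (j : Fin v.arity) (w : Vertex (ch k))
      (m : Fin w.arity), (∀ v w, (Γ (child k w)).2 < (Γ (child i v)).2) →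
      Γ.edge (child i v) j ∩ Γ.edge (child k w) m = ∅ := by
    intro i k v j w m hlt
    rw [Set.eq_empty_iff_forall_notMem]
    rintro X ⟨h1, h2⟩
    have hi : IsTidy fun v => Γ (child i v) := h.2.2.2 i
    have hk : IsTidy fun v => Γ (child k v) := h.2.2.2 k
    have hX := snd_le_of_mem_segment h2 (y := (Γ (child i (v.kid j))).2 - 1)
      (Int.le_sub_one_of_lt (hlt _ _)) (Int.le_sub_one_of_lt (hlt _ _))
    have hX' := le_snd_of_mem_segment h1 (y := (Γ (child i (v.kid j))).2)
      (hi.kid_lt v j).le le_rfl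
    push_cast at hX
    linarith
  have sep : (∀ v w, (Γ (child k w)).2 < (Γ (child i v)).2) ∨
      (∀ w v, (Γ (child i v)).2 < (Γ (child k w)).2) := by
    rcases lt_or_gt_of_ne hik with hik | hik
    · rcases h.2.1 i k hik with hc | hc
      · exact Or.inl hc.1
      · exact Or.inr fun w v => hc.1 v w
    · rcases h.2.1 k i hik with hc | hc
      · exact Or.inr hc.1
      · exact Or.inl fun v w => hc.1 w v
  rcases sep with hlt | hlt
  · exact key v j w m hlt
  · rw [Set.inter_comm]
    exact key w m v j hlt

end Node

theorem IsTidy.isPlanar {T : OrderedTree} {Γ : StraightLineDrawing T} (h : Γ.IsTidy) :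
    Γ.IsPlanar := by
  refine ⟨h.injective, ?_⟩
  induction T with
  | node d ch ih =>
    intro v w i j hne
    cases v with
    | root =>
      cases w with
      | root =>
        intro X hX
        have hij : i ≠ j := fun hij => hne (by rw [hij])
        rw [h.edge_root_inter_edge_root hij hX]
        exact ⟨root, by simp, rfl⟩
      | child k w =>
        by_cases hik : i = k
        · subst hik
          intro X hX
          obtain ⟨rfl, rfl⟩ := h.edge_root_inter_edge_same_child i w j hX
          exact ⟨child i root, by simp [kid], rfl⟩
        · exact (h.edge_root_inter_edge_child hik w j).subset.trans (Set.empty_subset _)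
    | child k v =>
      cases w with
      | root =>
        by_cases hjk : j = k
        · subst hjk
          intro X hX
          obtain ⟨rfl, rfl⟩ := h.edge_root_inter_edge_same_child j v i (Set.inter_comm _ _ ▸ hX)
          exact ⟨child j root, by simp [kid], rfl⟩
        · rw [Set.inter_comm]
          exact (h.edge_root_inter_edge_child hjk v i).subset.trans (Set.empty_subset _)
      | child l w =>
        by_cases hkl : k = l
        · subst hkl
          have hne' : v.kid i ≠ w.kid j := fun he => hne (congrArg (child k) he)
          intro X hX
          obtain ⟨u, ⟨hu1, hu2⟩, rfl⟩ := ih k (h.2.2.2 k) v w i j hne' hX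
          refine ⟨child k u, ⟨?_, ?_⟩, rfl⟩
          · rcases hu1 with rfl | rfl
            · exact Or.inl rfl
            · exact Or.inr rfl
          · rcases hu2 with rfl | rfl
            · exact Or.inl rfl
            · exact Or.inr rfl
        · exact (h.edge_child_inter_edge_child hkl v i w j).subset.trans (Set.empty_subset _)

theorem IsTidy.isGLR {T : OrderedTree} {Γ : StraightLineDrawing T} (h : Γ.IsTidy) : Γ.IsGLR :=
  ⟨h.isPlanar, h.isOrderPreserving, h.exists_path⟩

theorem IsTidy.add_const {T : OrderedTree} {Γ : StraightLineDrawing T} (h : Γ.IsTidy)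
    (P : ℤ × ℤ) : IsTidy fun v => Γ v + P := by
  induction T with
  | node d ch ih =>
    obtain ⟨h1, h2, ⟨π, a, h3, h4⟩, h5⟩ := h
    refine ⟨fun i v => by simpa using h1 i v, fun i j hij => ?_, ⟨π, a + P.1, ⟨?_, ?_⟩, ?_, ?_⟩,
      fun i => ih i (h5 i)⟩
    · simpa using h2 i j hij
    · intro v hv
      simpa using h3.1 v hv
    · intro v i hv hi
      simpa using h3.2 v i hv hi
    · intro v hv
      simpa using h4.1 v hv
    · intro v hv
      simpa using h4.2 v hv

end StraightLineDrawing

/-! ### Stacking the drawings of subtrees -/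

/-- The tree has a tidy drawing with the root at the origin, contained in the columns from `-l` to
`r` and the rows from `-h` to `0`, in which the path `π` is vertical and separating. -/
def FitsAlong {T : OrderedTree} (π : LeafPath T) (l r h : ℕ) : Prop :=
  ∃ Γ : StraightLineDrawing T, Γ.IsTidy ∧ Γ root = 0 ∧
    (∀ v, -(l : ℤ) ≤ (Γ v).1 ∧ (Γ v).1 ≤ r ∧ -(h : ℤ) ≤ (Γ v).2) ∧
    Γ.IsVerticalPath π 0 ∧ Γ.IsSeparatedBy π 0

/-- The tree has a tidy drawing with the root at the origin, contained in the columns from `-l` to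
`r` and the rows from `-h` to `0`, with a vertical separating path. -/
def Fits (T : OrderedTree) (l r h : ℕ) : Prop := ∃ π : LeafPath T, FitsAlong π l r h

theorem Fits.mono {T : OrderedTree} {l r h l' r' h' : ℕ} (H : Fits T l r h) (hl : l ≤ l')
    (hr : r ≤ r') (hh : h ≤ h') : Fits T l' r' h' := by
  obtain ⟨π, Γ, h1, h2, h3, h4⟩ := H
  refine ⟨π, Γ, h1, h2, fun v => ?_, h4⟩
  have := h3 v
  omega

/-- The depth below the root of the `j`-th child if exactly the children in `A` are drawn above it,
where `h` gives the heights of the drawings and `e` the numbers of empty rows above them. -/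
def stackDepth {d : ℕ} (h e : Fin d → ℕ) (A : Finset (Fin d)) (j : Fin d) : ℕ :=
  1 + e j + ∑ k ∈ A, (h k + 1 + e k)

/-- A child takes `h + 1 + e` rows, as `h` counts only the rows below its root. So `j` ends above
`k` once `j` and everything above it are above `k`. -/
theorem stackDepth_add_lt {d : ℕ} (h e : Fin d → ℕ) {A B : Finset (Fin d)} {j : Fin d} (k : Fin d)
    (hj : j ∉ A) (hAB : insert j A ⊆ B) : stackDepth h e A j + h j < stackDepth h e B k := by
  have := Finset.sum_le_sum_of_subset (f := fun k => h k + 1 + e k) hAB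
  rw [Finset.sum_insert hj] at this
  unfold stackDepth
  omega

theorem stackDepth_add_le {d : ℕ} (h e : Fin d → ℕ) {A B : Finset (Fin d)} {j : Fin d}
    (hj : j ∉ A) (hAB : insert j A ⊆ B) :
    stackDepth h e A j + h j ≤ ∑ k ∈ B, (h k + 1 + e k) := by
  have := Finset.sum_le_sum_of_subset (f := fun k => h k + 1 + e k) hAB
  rw [Finset.sum_insert hj] at this
  unfold stackDepth
  omega

/-- Draw a tree by stacking drawings of the subtrees at the children of the root in disjoint rows:
`X j` is the column of the `j`-th child and `A j` is the set of the children above it. -/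
theorem fitsAlong_node {d : ℕ} {ch : Fin d → OrderedTree} {i : Fin d} {π : LeafPath (ch i)}
    {L R h : Fin d → ℕ} (hi : FitsAlong π (L i) (R i) (h i))
    (hfits : ∀ j, j ≠ i → Fits (ch j) (L j) (R j) (h j))
    (X : Fin d → ℤ) (e : Fin d → ℕ) (A : Fin d → Finset (Fin d)) {l r H : ℕ}
    (hA : ∀ j, j ∉ A j)
    (hpair : ∀ j k, j < k →
      (insert j (A j) ⊆ A k ∧ ∀ x y : ℤ, X j - L j ≤ x → x ≤ X j + R j →
        -(stackDepth h e (A j) j + h j : ℤ) ≤ y → y ≤ -stackDepth h e (A j) j →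
        0 < cross (x, y) (X k, -stackDepth h e (A k) k)) ∨
      (insert k (A k) ⊆ A j ∧ ∀ x y : ℤ, X k - L k ≤ x → x ≤ X k + R k →
        -(stackDepth h e (A k) k + h k : ℤ) ≤ y → y ≤ -stackDepth h e (A k) k →
        0 < cross (X j, -stackDepth h e (A j) j) (x, y)))
    (hXi : X i = 0) (hleft : ∀ j < i, X j + R j < 0) (hright : ∀ j, i < j → 0 < X j - L j)
    (hl : ∀ j, -(l : ℤ) ≤ X j - L j) (hr : ∀ j, X j + R j ≤ r)
    (hH : ∑ k, (h k + 1 + e k) ≤ H) :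
    FitsAlong (LeafPath.step (ch := ch) i π) l r H := by
  -- Drawings are chosen for all children at once, but that of child `i` must be the one along `π`;
  -- the last clause records this by transport along `j = i`.
  have hex : ∀ j, ∃ Γ : StraightLineDrawing (ch j), Γ.IsTidy ∧ Γ root = 0 ∧
      (∀ v, -(L j : ℤ) ≤ (Γ v).1 ∧ (Γ v).1 ≤ R j ∧ -(h j : ℤ) ≤ (Γ v).2) ∧
      ∀ π' : LeafPath (ch i), π' = π → ∀ hj : j = i,
        StraightLineDrawing.IsVerticalPath (T := ch i) (hj ▸ Γ) π' 0 ∧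
        StraightLineDrawing.IsSeparatedBy (T := ch i) (hj ▸ Γ) π' 0 := by
    intro j
    by_cases hj : j = i
    · subst hj
      obtain ⟨Γ, h1, h2, h3, h4⟩ := hi
      exact ⟨Γ, h1, h2, h3, by rintro _ rfl _; exact h4⟩
    · obtain ⟨_, Γ, h1, h2, h3, -⟩ := hfits j hj
      exact ⟨Γ, h1, h2, h3, fun _ _ h => absurd h hj⟩
  choose Γ htidy hroot hbox hpath using hex
  have hvert := (hpath i π rfl rfl).1
  have hsep := (hpath i π rfl rfl).2
  dsimp only at hvert hsep
  clear hpath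
  set D : Fin d → ℕ := fun j => stackDepth h e (A j) j with hD
  let P : Fin d → ℤ × ℤ := fun j => (X j, -(D j : ℤ))
  let Δ : StraightLineDrawing (node d ch) := fun v => match v with
    | root => 0
    | child j v => Γ j v + P j
  have hroot' : Δ root = 0 := rfl
  have hchild : ∀ j (v : Vertex (ch j)), Δ (child j v) = Γ j v + P j := fun _ _ => rfl
  have hcr : ∀ j, Δ (child j root) = P j := fun j => by rw [hchild, hroot, zero_add]
  have hbox' : ∀ j (v : Vertex (ch j)), X j - L j ≤ (Δ (child j v)).1 ∧
      (Δ (child j v)).1 ≤ X j + R j ∧ -(D j + h j : ℤ) ≤ (Δ (child j v)).2 ∧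
      (Δ (child j v)).2 ≤ -(D j : ℤ) := by
    intro j v
    have h1 := hbox j v
    have h2 := (htidy j).le_root v
    rw [hroot] at h2
    simp only [Prod.snd_zero] at h2
    simp only [hchild, P, Prod.fst_add, Prod.snd_add]
    omega
  have hDpos : ∀ j, 0 < D j := fun j => by
    simp only [hD, stackDepth]
    omega
  have hvert' : Δ.IsVerticalPath (LeafPath.step (ch := ch) i π) 0 := by
    refine ⟨fun v hv => ?_, fun v k hv hk => ?_⟩
    · cases hv with
      | root => rfl
      | step hv => simp [hchild, P, hvert.1 _ hv, hXi]
    · cases hv with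
      | root =>
        have hk' := (hbox' k root).2.2.2
        have := hDpos k
        change (Δ (child k root)).2 < (0 : ℤ × ℤ).2
        simp only [Prod.snd_zero]
        omega
      | step hv =>
        cases hk with
        | step hk =>
          exact (add_lt_add_iff_right (P i).2).2 (hvert.2 _ _ hv hk)
  have hsep' : Δ.IsSeparatedBy (LeafPath.step (ch := ch) i π) 0 := by
    refine ⟨fun v hv => ?_, fun v hv => ?_⟩
    · cases hv with
      | here hj =>
        have := hbox' _ ‹_›
        have := hleft _ hj
        omega
      | deeper hv => simpa [hchild, P, hXi] using hsep.1 _ hv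
    · cases hv with
      | here hj =>
        have := hbox' _ ‹_›
        have := hright _ hj
        omega
      | deeper hv => simpa [hchild, P, hXi] using hsep.2 _ hv
  refine ⟨Δ, ⟨?_, ?_, ⟨_, _, hvert', hsep'⟩, fun j => (htidy j).add_const (P j)⟩, rfl, ?_,
    hvert', hsep'⟩
  · intro j v
    have := hbox' j v
    have := hDpos j
    rw [hroot', Prod.snd_zero]
    omega
  · intro j k hjk
    simp only [hroot', sub_zero, hcr]
    rcases hpair j k hjk with ⟨h1, h2⟩ | ⟨h1, h2⟩
    · refine Or.inl ⟨fun v w => ?_, fun v => ?_⟩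
      · have := hbox' j v
        have := hbox' k w
        have : D j + h j < D k := stackDepth_add_lt h e k (hA j) h1
        omega
      · obtain ⟨b1, b2, b3, b4⟩ := hbox' j v
        exact h2 _ _ b1 b2 b3 b4
    · refine Or.inr ⟨fun v w => ?_, fun w => ?_⟩
      · have := hbox' j v
        have := hbox' k w
        have : D k + h k < D j := stackDepth_add_lt h e j (hA k) h1
        omega
      · obtain ⟨b1, b2, b3, b4⟩ := hbox' k w
        exact h2 _ _ b1 b2 b3 b4
  · intro v
    cases v with
    | root => simp [hroot']
    | child j v =>
      have := hbox' j v
      have := hl j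
      have := hr j
      have : D j + h j ≤ _ := stackDepth_add_le h e (hA j) (Finset.subset_univ _)
      omega

/-- A tree whose first child can be drawn with a corner root can be drawn with a corner root as
well: the `j`-th child is in column `q j`, the last child is the uppermost one, and the edge to the
`j`-th child is steep enough to pass below all later ones. -/
theorem fits_corner {d : ℕ} {ch : Fin (d + 1) → OrderedTree} {L R h : Fin (d + 1) → ℕ}
    (hfits : ∀ j, Fits (ch j) (L j) (R j) (h j)) (q e : Fin (d + 1) → ℕ) (hL0 : L 0 = 0)
    (hq0 : q 0 = 0) (hLq : ∀ j, j ≠ 0 → L j < q j)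
    (hslope : ∀ j, (∀ k, j < k → q j + L k ≤ q k) ∨
      (e j = ∑ k ∈ Finset.univ.filter (j < ·), (h k + 1 + e k) ∧
        ∀ k, j < k → q j + 2 * L k ≤ 2 * q k))
    {r H : ℕ} (hr : ∀ j, q j + R j ≤ r) (hH : ∑ k, (h k + 1 + e k) ≤ H) :
    Fits (node (d + 1) ch) 0 r H := by
  obtain ⟨π, hπ⟩ := hfits 0
  have hA : ∀ j : Fin (d + 1), j ∉ Finset.univ.filter (j < ·) := fun j => by simp
  have hAA : ∀ j k : Fin (d + 1), j < k →
      insert k (Finset.univ.filter (k < ·)) ⊆ Finset.univ.filter (j < ·) := by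
    intro j k hjk x hx
    simp only [Finset.mem_insert, Finset.mem_filter, Finset.mem_univ, true_and] at hx ⊢
    rcases hx with rfl | hx
    · exact hjk
    · exact hjk.trans hx
  refine ⟨_, fitsAlong_node hπ (fun j _ => hfits j) (fun j => (q j : ℤ)) e
    (fun j => Finset.univ.filter (j < ·)) hA ?_ ?_ ?_ ?_ ?_ ?_ hH⟩
  · refine fun j k hjk => Or.inr ⟨hAA j k hjk, fun x y hx _ hy _ => ?_⟩
    have hk0 : k ≠ 0 := (lt_of_le_of_lt (Fin.zero_le j) hjk).ne'
    have hLk := hLq k hk0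
    have hx1 : 1 ≤ x := by omega
    have hD := stackDepth_add_lt h e j (hA k) (hAA j k hjk)
    have hS := stackDepth_add_le h e (hA k) (hAA j k hjk)
    simp only [cross]
    -- Either the later subtree starts no further left than column `q j`, or child `j` has depth 1 +
    -- 2S while the later subtrees end by depth S, where the edge has covered at most half of its
    -- horizontal extent.
    rcases hslope j with h1 | ⟨h1, h2⟩
    · have hqx : (q j : ℤ) ≤ x := by
        have := h1 k hjk
        omega
      generalize stackDepth h e (Finset.univ.filter (j < ·)) j = D at *
      have hyD : 1 ≤ y + D := by omega
      nlinarith [mul_nonneg (sub_nonneg.2 hqx) (Int.natCast_nonneg D),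
        mul_nonneg (Int.natCast_nonneg (q j)) (sub_nonneg.2 hyD)]
    · have hqx : (q j : ℤ) ≤ 2 * x := by
        have := h2 k hjk
        omega
      have hDj : stackDepth h e (Finset.univ.filter (j < ·)) j =
          1 + 2 * ∑ k ∈ Finset.univ.filter (j < ·), (h k + 1 + e k) := by
        unfold stackDepth
        omega
      rw [hDj]
      generalize ∑ k ∈ Finset.univ.filter (j < ·), (h k + 1 + e k) = S at *
      have hyS : 0 ≤ y + S := by omega
      push_cast
      nlinarith [mul_nonneg (sub_nonneg.2 hqx) (Int.natCast_nonneg S),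
        mul_nonneg (Int.natCast_nonneg (q j)) hyS]
  · simp [hq0]
  · exact fun j hj => absurd hj (Fin.not_lt_zero j)
  · intro j hj
    have := hLq j hj.ne'
    omega
  · intro j
    rcases eq_or_ne j 0 with rfl | hj
    · simp [hq0, hL0]
    · have := hLq j hj
      omega
  · exact fun j => by exact_mod_cast hr j

theorem fitsAlong_leaf {ch : Fin 0 → OrderedTree} (l r h : ℕ) :
    FitsAlong (LeafPath.leaf (ch := ch)) l r h := by
  have hv : StraightLineDrawing.IsVerticalPath (T := node 0 ch) (fun _ => 0) .leaf 0 :=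
    ⟨fun _ _ => rfl, fun v i _ _ => by cases v <;> exact Fin.elim0 ‹_›⟩
  have hs : StraightLineDrawing.IsSeparatedBy (T := node 0 ch) (fun _ => 0) .leaf 0 :=
    ⟨fun v hv => (by cases hv), fun v hv => (by cases hv)⟩
  exact ⟨fun _ => 0, ⟨fun i => i.elim0, fun i => i.elim0, ⟨_, _, hv, hs⟩, fun i => i.elim0⟩, rfl,
    fun _ => by simp, hv, hs⟩

/-- Draw a given path vertically, with the left and right subtrees stacked on both sides of it. The
function `G` bounds the number of rows in terms of the number of nodes. -/
theorem fitsAlong_of_subtrees {G : ℕ → ℕ} (hG1 : ∀ T : OrderedTree, 1 ≤ G T.size)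
    (hG : ∀ (d : ℕ) (ch : Fin d → OrderedTree), ∑ j, G (ch j).size < G (node d ch).size)
    {T : OrderedTree} (π : LeafPath T) {l r : ℕ}
    -- The conjunct `1 ≤ l` prevents truncation in `l - 1`. It is asked only in the presence of such
    -- a `T'`, so `l = 0` is allowed for a path without left subtrees.
    (hl : ∀ T' : OrderedTree, T'.size ≤ π.maxLeft → 1 ≤ l ∧ Fits T' (l - 1) 0 (G T'.size - 1))
    (hr : ∀ T' : OrderedTree, T'.size ≤ π.maxRight → 1 ≤ r ∧ Fits T' 0 (r - 1) (G T'.size - 1)) :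
    FitsAlong π l r (G T.size - 1) := by
  induction π with
  | leaf => exact fitsAlong_leaf _ _ _
  | @step d ch i π ih =>
    have hπ := ih (fun T' h => hl T' (h.trans (le_max_right _ _)))
      (fun T' h => hr T' (h.trans (le_max_right _ _)))
    have hbefore : ∀ j < i, 1 ≤ l ∧ Fits (ch j) (l - 1) 0 (G (ch j).size - 1) := fun j hj =>
      hl (ch j) ((Finset.le_sup (f := fun j => (ch j).size) (by simpa using hj)).trans
        (le_max_left _ _))
    have hafter : ∀ j, i < j → 1 ≤ r ∧ Fits (ch j) 0 (r - 1) (G (ch j).size - 1) := fun j hj =>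
      hr (ch j) ((Finset.le_sup (f := fun j => (ch j).size) (by simpa using hj)).trans
        (le_max_left _ _))
    have hlt : ∀ j < i, ¬ i < j ∧ j ≠ i := fun j hj => ⟨hj.not_gt, hj.ne⟩
    have hgt : ∀ j, i < j → ¬ j < i ∧ j ≠ i := fun j hj => ⟨hj.not_gt, hj.ne'⟩
    -- From top to bottom: the left siblings from the outside in (column -1), the right siblings
    -- from the outside in (column 1), and finally the path-child.
    refine fitsAlong_node
      (L := fun j => if j < i then l - 1 else if i < j then 0 else l)
      (R := fun j => if j < i then 0 else if i < j then r - 1 else r)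
      (h := fun j => G (ch j).size - 1) (by simpa using hπ) ?_
      (fun j => if j < i then -1 else if i < j then 1 else 0) (fun _ => 0)
      (fun j => Finset.univ.filter fun k =>
        if j < i then k < j else if i < j then k < i ∨ j < k else k ≠ i) ?_ ?_ (by simp) ?_ ?_ ?_ ?_ ?_
    · intro j hj
      rcases lt_or_gt_of_ne hj with h | h
      · simpa [h] using (hbefore j h).2
      · simpa [h, (hgt j h).1] using (hafter j h).2
    · intro j
      rcases lt_trichotomy j i with h | rfl | h
      · simp [h]
      · simp
      · simp [h, (hgt j h).1]
    · intro j k hjk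
      have hD : ∀ A j, 0 < stackDepth (fun j => G (ch j).size - 1) (fun _ => 0) A j := fun A j => by
        unfold stackDepth
        omega
      rcases lt_trichotomy k i with hki | rfl | hki
      · have hji := hjk.trans hki
        simp only [hki, hji, if_true, cross]
        have hA : insert j (Finset.univ.filter fun k => k < j) ⊆
            Finset.univ.filter fun j => j < k := by
          intro x hx
          simp only [Finset.mem_insert, Finset.mem_filter, Finset.mem_univ, true_and] at hx ⊢
          rcases hx with rfl | hx
          · exact hjk
          · exact hx.trans hjk
        refine Or.inl ⟨hA, fun x y _ hx hy _ => ?_⟩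
        have := stackDepth_add_lt (fun j => G (ch j).size - 1) (fun _ => 0) k (by simp) hA
        push_cast at hx
        have hx' : 0 ≤ -1 - x := by omega
        nlinarith [mul_nonneg hx' (Int.natCast_nonneg (stackDepth (fun j => G (ch j).size - 1)
          (fun _ => 0) (Finset.univ.filter fun j => j < k) k))]
      · simp only [hjk, if_true, cross, lt_irrefl, if_false]
        refine Or.inl ⟨?_, fun x y _ hx hy _ => ?_⟩
        · intro x hx
          simp only [Finset.mem_insert, Finset.mem_filter, Finset.mem_univ, true_and] at hx ⊢
          rcases hx with rfl | hx
          · exact hjk.ne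
          · exact (hx.trans hjk).ne
        · have hDk := hD (Finset.univ.filter fun j => j ≠ k) k
          push_cast at hx
          have hx' : 0 < - x := by omega
          have := mul_pos hx' (Int.natCast_pos.2 hDk)
          linarith
      · rcases lt_trichotomy j i with hji | rfl | hji
        · simp only [hji, hki, (hgt k hki).1, if_true, cross, if_false]
          refine Or.inl ⟨?_, fun x y _ hx hy hy' => ?_⟩
          · intro x hx
            simp only [Finset.mem_insert, Finset.mem_filter, Finset.mem_univ, true_and] at hx ⊢
            rcases hx with rfl | hx
            · exact Or.inl hji
            · exact Or.inl (hx.trans hji)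
          · have hDk := hD (Finset.univ.filter fun j => j < i ∨ k < j) k
            have hDj := hD (Finset.univ.filter fun k => k < j) j
            push_cast at hx
            have hx' : 0 < - x := by omega
            have := mul_pos hx' (Int.natCast_pos.2 hDk)
            have hy'' : y < 0 := by omega
            linarith
        · simp only [hki, (hgt k hki).1, if_true, cross, lt_irrefl, if_false]
          refine Or.inr ⟨?_, fun x y hx _ hy _ => ?_⟩
          · intro x hx
            simp only [Finset.mem_insert, Finset.mem_filter, Finset.mem_univ, true_and] at hx ⊢
            rcases hx with rfl | hx | hx
            · exact hki.ne'
            · exact hx.ne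
            · exact (hki.trans hx).ne'
          · have hDj := hD (Finset.univ.filter fun k => k ≠ j) j
            push_cast at hx
            have hx' : 0 < x := by omega
            have := mul_pos hx' (Int.natCast_pos.2 hDj)
            linarith
        · simp only [hki, (hgt k hki).1, hji, (hgt j hji).1, if_true, cross, if_false]
          have hA : insert k (Finset.univ.filter fun j => j < i ∨ k < j) ⊆
              Finset.univ.filter fun k => k < i ∨ j < k := by
            intro x hx
            simp only [Finset.mem_insert, Finset.mem_filter, Finset.mem_univ, true_and] at hx ⊢
            rcases hx with rfl | hx | hx
            · exact Or.inr hjk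
            · exact Or.inl hx
            · exact Or.inr (hjk.trans hx)
          refine Or.inr ⟨hA, fun x y hx _ hy _ => ?_⟩
          have := stackDepth_add_lt (fun j => G (ch j).size - 1) (fun _ => 0) j
            (by simp [hki.le]) hA
          push_cast at hx
          have hx' : 0 ≤ x - 1 := by omega
          nlinarith [mul_nonneg hx' (Int.natCast_nonneg (stackDepth (fun j => G (ch j).size - 1)
            (fun _ => 0) (Finset.univ.filter fun k => k < i ∨ j < k) j))]
    · intro j h
      simp [h]
    · intro j h
      simp [h, (hgt j h).1]
    · intro j
      rcases lt_trichotomy j i with h | rfl | h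
      · have := (hbefore j h).1
        simp only [h, if_true]
        omega
      · simp
      · simp [h, (hgt j h).1]
    · intro j
      rcases lt_trichotomy j i with h | rfl | h
      · simp only [h, if_true]
        omega
      · simp
      · have := (hafter j h).1
        simp only [h, (hgt j h).1, if_true, if_false]
        omega
    · have h1 := hG d ch
      have h2 : ∑ k, (G (ch k).size - 1 + 1 + 0) = ∑ k, G (ch k).size :=
        Finset.sum_congr rfl fun k _ => by
          have := hG1 (ch k)
          omega
      omega

/-! ### Mirror images -/

/-- One ordered tree is the mirror image of the other. -/
inductive IsMirror : OrderedTree → OrderedTree → Prop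
  | intro {d : ℕ} {ch ch' : Fin d → OrderedTree} :
      (∀ i, IsMirror (ch i) (ch' i.rev)) → IsMirror (node d ch) (node d ch')

theorem exists_isMirror (T : OrderedTree) : ∃ T', IsMirror T T' ∧ T'.size = T.size := by
  induction T with
  | node d ch ih =>
    choose ch' h1 h2 using ih
    refine ⟨node d fun i => ch' i.rev, .intro fun i => ?_, ?_⟩
    · rw [Fin.rev_rev]
      exact h1 i
    · simp only [size, h2]
      congr 1
      exact Fintype.sum_equiv Fin.revPerm _ _ fun i => rfl

/-- The reflection in the vertical axis. -/
def reflect (P : ℤ × ℤ) : ℤ × ℤ := (-P.1, P.2)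

theorem cross_reflect (P Q R : ℤ × ℤ) :
    cross (reflect P - reflect Q) (reflect R - reflect Q) = cross (R - Q) (P - Q) := by
  simp only [cross, reflect, Prod.fst_sub, Prod.snd_sub]
  ring

/-- The nodes and paths of a tree correspond to those of its mirror image. -/
structure IsMirrorMap {T T' : OrderedTree} (σ : Vertex T → Vertex T') : Prop where
  map_root : σ root = root
  map_kid : ∀ (v : Vertex T) (i : Fin v.arity), ∃ j, σ (v.kid i) = (σ v).kid j
  path : ∀ π' : LeafPath T', ∃ π : LeafPath T, ∀ v, (OnPath π v → OnPath π' (σ v)) ∧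
    (InLeftSubtree π v → InRightSubtree π' (σ v)) ∧ (InRightSubtree π v → InLeftSubtree π' (σ v))
  tidy : ∀ Γ : StraightLineDrawing T', Γ.IsTidy →
    StraightLineDrawing.IsTidy fun v => reflect (Γ (σ v))

theorem IsMirrorMap.exists_path {T T' : OrderedTree} {σ : Vertex T → Vertex T'}
    (hkid : ∀ (v : Vertex T) (i : Fin v.arity), ∃ j, σ (v.kid i) = (σ v).kid j)
    (hpath : ∀ π' : LeafPath T', ∃ π : LeafPath T, ∀ v, (OnPath π v → OnPath π' (σ v)) ∧
      (InLeftSubtree π v → InRightSubtree π' (σ v)) ∧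
      (InRightSubtree π v → InLeftSubtree π' (σ v)))
    {Γ : StraightLineDrawing T'} {π' : LeafPath T'} {a : ℤ} (h1 : Γ.IsVerticalPath π' a)
    (h2 : Γ.IsSeparatedBy π' a) :
    ∃ π : LeafPath T, StraightLineDrawing.IsVerticalPath (fun v => reflect (Γ (σ v))) π (-a) ∧
      StraightLineDrawing.IsSeparatedBy (fun v => reflect (Γ (σ v))) π (-a) := by
  obtain ⟨π, hπ⟩ := hpath π'
  refine ⟨π, ⟨fun v hv => ?_, fun v i hv hi => ?_⟩, fun v hv => ?_, fun v hv => ?_⟩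
  · simp only [reflect, h1.1 _ ((hπ v).1 hv)]
  · obtain ⟨j, hj⟩ := hkid v i
    have := (hπ _).1 hi
    simp only [reflect]
    rw [hj] at this ⊢
    exact h1.2 _ j ((hπ v).1 hv) this
  · exact neg_lt_neg (h2.2 _ ((hπ v).2.1 hv))
  · exact neg_lt_neg (h2.1 _ ((hπ v).2.2 hv))

/-- Reflection and reversal of the children both change the sign of the cross products, so the two
alternatives for a pair of siblings in `IsTidy` are exchanged. Bijectivity of the map is not needed.
-/
theorem IsMirror.exists_map {T T' : OrderedTree} (h : IsMirror T T') :
    ∃ σ : Vertex T → Vertex T', IsMirrorMap σ := by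
  induction h with
  | @intro d ch ch' _ ih =>
    choose σ hσ using ih
    let τ : Vertex (node d ch) → Vertex (node d ch') := fun v => match v with
      | root => root
      | child i v => child i.rev (σ i v)
    have hkid : ∀ (v : Vertex (node d ch)) (i : Fin v.arity), ∃ j, τ (v.kid i) = (τ v).kid j := by
      intro v i
      cases v with
      | root => exact ⟨Fin.rev i, congrArg (child _) (hσ i).map_root⟩
      | child k v =>
        obtain ⟨j, hj⟩ := (hσ k).map_kid v i
        exact ⟨j, congrArg (child _) hj⟩
    have hpath : ∀ π' : LeafPath (node d ch'), ∃ π : LeafPath (node d ch), ∀ v,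
        (OnPath π v → OnPath π' (τ v)) ∧ (InLeftSubtree π v → InRightSubtree π' (τ v)) ∧
        (InRightSubtree π v → InLeftSubtree π' (τ v)) := by
      intro π'
      cases π' with
      | leaf =>
        refine ⟨.leaf, fun v => ⟨fun hv => ?_, fun hv => (by cases hv), fun hv => (by cases hv)⟩⟩
        cases hv
        exact .root _
      | step i π' =>
        obtain ⟨i, rfl⟩ := Fin.rev_surjective i
        obtain ⟨π, hπ⟩ := (hσ i).path π'
        refine ⟨.step i π, fun v => ⟨fun hv => ?_, fun hv => ?_, fun hv => ?_⟩⟩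
        · cases hv with
          | root => exact .root _
          | step hv => exact .step ((hπ _).1 hv)
        · cases hv with
          | here hj => exact .here (Fin.rev_lt_rev.2 hj)
          | deeper hv => exact .deeper ((hπ _).2.1 hv)
        · cases hv with
          | here hj => exact .here (Fin.rev_lt_rev.2 hj)
          | deeper hv => exact .deeper ((hπ _).2.2 hv)
    refine ⟨τ, rfl, hkid, hpath, fun Γ hΓ => ?_⟩
    obtain ⟨h1, h2, ⟨π', a, h3, h4⟩, h5⟩ := hΓ
    obtain ⟨π, hπ⟩ := IsMirrorMap.exists_path hkid hpath h3 h4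
    refine ⟨fun i v => h1 i.rev (σ i v), fun i j hij => ?_, ⟨π, -a, hπ⟩,
      fun i => (hσ i).tidy _ (h5 i.rev)⟩
    have hi : τ (child i root) = child i.rev root := congrArg (child _) (hσ i).map_root
    have hj : τ (child j root) = child j.rev root := congrArg (child _) (hσ j).map_root
    simp only [cross_reflect, hi, hj]
    rcases h2 j.rev i.rev (Fin.rev_lt_rev.2 hij) with ⟨h6, h7⟩ | ⟨h6, h7⟩
    · exact Or.inr ⟨fun v w => h6 (σ j w) (σ i v), fun w => h7 (σ j w)⟩
    · exact Or.inl ⟨fun v w => h6 (σ j w) (σ i v), fun v => h7 (σ i v)⟩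

theorem Fits.of_isMirror {T T' : OrderedTree} {l r h : ℕ} (H : Fits T' l r h)
    (hT : IsMirror T T') : Fits T r l h := by
  obtain ⟨σ, hσ⟩ := hT.exists_map
  obtain ⟨π', Γ, h1, h2, h3, h4, h5⟩ := H
  obtain ⟨π, hv, hs⟩ := IsMirrorMap.exists_path hσ.map_kid hσ.path h4 h5
  refine ⟨π, _, hσ.tidy Γ h1, ?_, fun v => ?_, by simpa using hv, by simpa using hs⟩
  · simp [hσ.map_root, h2, reflect]
  · have := h3 (σ v)
    simp only [reflect]
    omega

/-! ### Row and column budgets, and the recursion -/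

/-- An upper bound for the number of rows of a drawing of a tree with `n` nodes. -/
noncomputable def rowBound (n : ℕ) : ℕ := ⌊(n : ℝ) ^ (37 / 25 : ℝ)⌋₊

theorem rpow_eq_mul_rpow (n : ℕ) : (n : ℝ) ^ (37 / 25 : ℝ) = n * (n : ℝ) ^ (12 / 25 : ℝ) := by
  rcases Nat.eq_zero_or_pos n with rfl | hn
  · norm_num
  · have : (0 : ℝ) < n := by exact_mod_cast hn
    rw [← Real.rpow_one_add' this.le (by norm_num)]
    norm_num

theorem rowBound_le (n : ℕ) : (rowBound n : ℝ) ≤ n * (n : ℝ) ^ (12 / 25 : ℝ) :=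
  (Nat.floor_le (by positivity)).trans_eq (rpow_eq_mul_rpow n)

theorem one_le_size_rpow (T : OrderedTree) : 1 ≤ (T.size : ℝ) ^ (12 / 25 : ℝ) :=
  Real.one_le_rpow (by exact_mod_cast T.size_pos) (by norm_num)

theorem one_le_rowBound (T : OrderedTree) : 1 ≤ rowBound T.size := by
  refine Nat.le_floor ?_
  rw [Nat.cast_one]
  exact Real.one_le_rpow (by exact_mod_cast T.size_pos) (by norm_num)

theorem size_rpow_le {d : ℕ} (ch : Fin d → OrderedTree) (j : Fin d) :
    ((ch j).size : ℝ) ^ (12 / 25 : ℝ) ≤ ((node d ch).size : ℝ) ^ (12 / 25 : ℝ) :=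
  Real.rpow_le_rpow (by positivity) (by exact_mod_cast (size_child_lt ch j).le) (by norm_num)

/-- The rows for the drawings of the subtrees at the children can be allotted twice for those
children that are small. -/
theorem sum_rowBound_lt {d : ℕ} (ch : Fin d → OrderedTree) (A : Finset (Fin d))
    (hA : ∀ j ∈ A, 2 * ((ch j).size : ℝ) ^ (12 / 25 : ℝ) ≤
      ((node d ch).size : ℝ) ^ (12 / 25 : ℝ)) :
    ∑ j, rowBound (ch j).size + ∑ j ∈ A, rowBound (ch j).size < rowBound (node d ch).size := by
  rw [Nat.lt_iff_add_one_le]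
  refine Nat.le_floor ?_
  rw [rpow_eq_mul_rpow]
  have h1 := one_le_size_rpow (node d ch)
  set N := ((node d ch).size : ℝ) ^ (12 / 25 : ℝ)
  have hA' : ∑ j ∈ A, (rowBound (ch j).size : ℝ) =
      ∑ j, if j ∈ A then (rowBound (ch j).size : ℝ) else 0 := by simp
  have hsize : ((node d ch).size : ℝ) = 1 + ∑ j, ((ch j).size : ℝ) := by simp [size]
  push_cast
  -- With n = 1 + ∑ s_j, the budget n · n^p is n^p + ∑ s_j n^p. The first term pays for the root,
  -- and s_j n^p covers s_j^(1+p), even twice if 2 s_j^p ≤ n^p.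
  rw [hA', ← Finset.sum_add_distrib, hsize, add_mul, one_mul, Finset.sum_mul, add_comm]
  refine add_le_add h1 (Finset.sum_le_sum fun j _ => ?_)
  have hj := rowBound_le (ch j).size
  have hs : (0 : ℝ) ≤ (ch j).size := by positivity
  split_ifs with hjA
  · nlinarith [mul_le_mul_of_nonneg_left (hA j hjA) hs]
  · nlinarith [mul_le_mul_of_nonneg_left (size_rpow_le ch j) hs]

theorem LeafPath.maxLeft_lt {T : OrderedTree} (π : LeafPath T) : π.maxLeft < T.size := by
  induction π with
  | leaf => exact size_pos _
  | @step d ch i π ih =>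
    simp only [LeafPath.maxLeft, max_lt_iff]
    refine ⟨(Finset.sup_lt_iff (size_pos _)).2 fun j _ => size_child_lt ch j, ?_⟩
    exact ih.trans (size_child_lt ch i)

theorem LeafPath.maxRight_lt {T : OrderedTree} (π : LeafPath T) : π.maxRight < T.size := by
  induction π with
  | leaf => exact size_pos _
  | @step d ch i π ih =>
    simp only [LeafPath.maxRight, max_lt_iff]
    refine ⟨(Finset.sup_lt_iff (size_pos _)).2 fun j _ => size_child_lt ch j, ?_⟩
    exact ih.trans (size_child_lt ch i)

/-- There is a narrow drawing with the root in the top row. -/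
def HasTopDrawing (T : OrderedTree) : Prop :=
  ∃ l r : ℕ, Fits T l r (rowBound T.size - 1) ∧
    (l + r + 2 : ℝ) ≤ 20000 * (T.size : ℝ) ^ (12 / 25 : ℝ)

/-- There is a narrow drawing with the root in the top left corner. -/
def HasTopLeftDrawing (T : OrderedTree) : Prop :=
  ∃ r : ℕ, Fits T 0 r (rowBound T.size - 1) ∧
    (r + 1 : ℝ) ≤ 20000 * (T.size : ℝ) ^ (12 / 25 : ℝ)

/-- There is a narrow drawing with the root in the top right corner. -/
def HasTopRightDrawing (T : OrderedTree) : Prop :=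
  ∃ l : ℕ, Fits T l 0 (rowBound T.size - 1) ∧
    (l + 1 : ℝ) ≤ 20000 * (T.size : ℝ) ^ (12 / 25 : ℝ)

theorem hasTopDrawing_of_smaller {T : OrderedTree}
    (hleft : ∀ T' : OrderedTree, T'.size < T.size → HasTopLeftDrawing T')
    (hright : ∀ T' : OrderedTree, T'.size < T.size → HasTopRightDrawing T') :
    HasTopDrawing T := by
  obtain ⟨π, hπ⟩ := exists_balanced_path T
  refine ⟨⌊20000 * (π.maxLeft : ℝ) ^ (12 / 25 : ℝ)⌋₊, ⌊20000 * (π.maxRight : ℝ) ^ (12 / 25 : ℝ)⌋₊,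
    ⟨π, fitsAlong_of_subtrees one_le_rowBound
      (fun d ch => by simpa using sum_rowBound_lt ch ∅ (by simp)) π
      (fun T' hT' => ?_) (fun T' hT' => ?_)⟩, ?_⟩
  · obtain ⟨l, h1, h2⟩ := hright T' (hT'.trans_lt π.maxLeft_lt)
    have : l + 1 ≤ ⌊20000 * (π.maxLeft : ℝ) ^ (12 / 25 : ℝ)⌋₊ := by
      refine Nat.le_floor ?_
      push_cast
      exact h2.trans (by gcongr)
    exact ⟨by omega, h1.mono (by omega) le_rfl le_rfl⟩
  · obtain ⟨r, h1, h2⟩ := hleft T' (hT'.trans_lt π.maxRight_lt)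
    have : r + 1 ≤ ⌊20000 * (π.maxRight : ℝ) ^ (12 / 25 : ℝ)⌋₊ := by
      refine Nat.le_floor ?_
      push_cast
      exact h2.trans (by gcongr)
    exact ⟨by omega, h1.mono le_rfl (by omega) le_rfl⟩
  · have h1 := Nat.floor_le (a := 20000 * (π.maxLeft : ℝ) ^ (12 / 25 : ℝ)) (by positivity)
    have h2 := Nat.floor_le (a := 20000 * (π.maxRight : ℝ) ^ (12 / 25 : ℝ)) (by positivity)
    -- The deficit 20000 · (1/10000) · n^p is at least 2; this fixes the constant 20000.
    linarith [one_le_size_rpow T]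

theorem le_rpow_of_pow_le {x y : ℝ} (hy : 0 ≤ y) (h : x ^ 25 ≤ y ^ 12) :
    x ≤ y ^ (12 / 25 : ℝ) := by
  refine le_of_pow_le_pow_left₀ (n := 25) (by norm_num) (by positivity) (h.trans_eq ?_)
  rw [← Real.rpow_natCast (y ^ (12 / 25 : ℝ)), ← Real.rpow_mul hy, ← Real.rpow_natCast]
  norm_num

/-- If one of two disjoint subtrees is so large that its power is close to that of the whole tree,
then the power of the other one is at most half as large. -/
theorem two_mul_rpow_le {m s n : ℕ} (hm : 1 ≤ m) (hn : s + m ≤ n)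
    (h : (n : ℝ) ^ (12 / 25 : ℝ) < (m : ℝ) ^ (12 / 25 : ℝ) + 1 / 20) :
    2 * (s : ℝ) ^ (12 / 25 : ℝ) ≤ (m : ℝ) ^ (12 / 25 : ℝ) := by
  -- If 5s ≤ m, then 5^p ≥ 2 suffices. Otherwise n ≥ 6m/5, and (6/5)^p ≥ 21/20 makes n^p exceed m^p
  -- by at least m^p/20 ≥ 1/20.
  by_cases h5 : 5 * s ≤ m
  · have h5' : (5 * s : ℝ) ≤ m := by exact_mod_cast h5
    have h2 : (2 : ℝ) ≤ 5 ^ (12 / 25 : ℝ) := le_rpow_of_pow_le (by norm_num) (by norm_num)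
    calc 2 * (s : ℝ) ^ (12 / 25 : ℝ) ≤ 5 ^ (12 / 25 : ℝ) * (s : ℝ) ^ (12 / 25 : ℝ) := by gcongr
      _ = (5 * s : ℝ) ^ (12 / 25 : ℝ) := by rw [Real.mul_rpow (by norm_num) (by positivity)]
      _ ≤ (m : ℝ) ^ (12 / 25 : ℝ) := by gcongr
  · exfalso
    have h6 : (6 / 5 * m : ℝ) ≤ n := by
      have : (6 * m : ℝ) ≤ 5 * n := by exact_mod_cast (by omega : 6 * m ≤ 5 * n)
      linarith
    have h2 : (21 / 20 : ℝ) ≤ (6 / 5) ^ (12 / 25 : ℝ) :=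
      le_rpow_of_pow_le (by norm_num) (by norm_num)
    have h1 : (1 : ℝ) ≤ (m : ℝ) ^ (12 / 25 : ℝ) :=
      Real.one_le_rpow (by exact_mod_cast hm) (by norm_num)
    have : 21 / 20 * (m : ℝ) ^ (12 / 25 : ℝ) ≤ (n : ℝ) ^ (12 / 25 : ℝ) := calc
      _ ≤ (6 / 5) ^ (12 / 25 : ℝ) * (m : ℝ) ^ (12 / 25 : ℝ) := by gcongr
      _ = (6 / 5 * m : ℝ) ^ (12 / 25 : ℝ) := by rw [Real.mul_rpow (by norm_num) (by positivity)]
      _ ≤ _ := by gcongr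
    linarith

theorem hasTopLeftDrawing_of_smaller {T : OrderedTree}
    (hleft : ∀ T' : OrderedTree, T'.size < T.size → HasTopLeftDrawing T')
    (htop : ∀ T' : OrderedTree, T'.size < T.size → HasTopDrawing T') :
    HasTopLeftDrawing T := by
  obtain ⟨d, ch⟩ := T
  rcases d with _ | d
  · refine ⟨0, ⟨_, fitsAlong_leaf _ _ _⟩, ?_⟩
    have := one_le_size_rpow (node 0 ch)
    push_cast
    linarith
  have hN := one_le_size_rpow (node (d + 1) ch)
  have hmono := size_rpow_le ch
  set N := ((node (d + 1) ch).size : ℝ) ^ (12 / 25 : ℝ)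
  have hpos := fun j => one_le_size_rpow (ch j)
  choose ρ hρ hρ' using fun j => hleft (ch j) (size_child_lt ch j)
  have hrows : ∀ j, rowBound (ch j).size - 1 + 1 = rowBound (ch j).size := fun j => by
    have := one_le_rowBound (ch j)
    omega
  have width : ∀ x : ℕ, (x + 1 : ℝ) ≤ 20000 * N → x ≤ ⌊20000 * N⌋₊ - 1 := fun x hx => by
    have : x + 1 ≤ ⌊20000 * N⌋₊ := Nat.le_floor (by exact_mod_cast hx)
    omega
  have hfloor : 1 ≤ ⌊20000 * N⌋₊ := Nat.le_floor (by push_cast; linarith)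
  refine ⟨⌊20000 * N⌋₊ - 1, ?_, ?_⟩
  swap
  · rw [Nat.cast_sub hfloor, Nat.cast_one, sub_add_cancel]
    exact Nat.floor_le (by linarith)
  -- `b` is a child that cannot afford to be moved to column 1 in a corner drawing. Its siblings
  -- then have at most half of its power.
  by_cases hbig : ∃ b, b ≠ 0 ∧ 20000 * N < 20000 * ((ch b).size : ℝ) ^ (12 / 25 : ℝ) + 1
  · obtain ⟨b, hb0, hb⟩ := hbig
    have hsmall : ∀ j, j ≠ b → 2 * ((ch j).size : ℝ) ^ (12 / 25 : ℝ) ≤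
        ((ch b).size : ℝ) ^ (12 / 25 : ℝ) := by
      intro j hj
      refine two_mul_rpow_le (size_pos _) (n := (node (d + 1) ch).size) ?_ (by linarith)
      rcases lt_or_gt_of_ne hj with h | h
      · exact (size_add_size_lt ch h).le
      · rw [add_comm]
        exact (size_add_size_lt ch h).le
    obtain ⟨l, r, hlr, hw⟩ := htop (ch b) (size_child_lt ch b)
    have hLq : ∀ j, j ≠ 0 → (if j = b then l else 0) <
        (if j = 0 then 0 else if j < b then 1 else if j = b then l + 1 else (l + 2) / 2) := by
      intro j hj
      rcases lt_trichotomy j b with h | rfl | h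
      · simp [hj, h, h.ne]
      · simp [hj]
      · simp only [hj, h.ne', h.not_gt, if_false]
        omega
    -- The type I drawing of `b`, with root in column l + 1, starts in column 1; with column 0 this
    -- makes l + r + 2 columns, exactly what its bound covers. Later siblings start in column (l +
    -- 2) / 2, thanks to the empty rows `e b`. That offset and their own width each take at most
    -- half of the bound for `b`.
    refine fits_corner (L := fun j => if j = b then l else 0)
      (R := fun j => if j = b then r else ρ j) (h := fun j => rowBound (ch j).size - 1) ?_
      (fun j => if j = 0 then 0 else if j < b then 1 else if j = b then l + 1 else (l + 2) / 2)
      (fun j => if j = b then ∑ k ∈ Finset.univ.filter (b < ·), rowBound (ch k).size else 0)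
      (by simp [hb0.symm]) (by simp) hLq ?_ ?_ ?_
    · intro j
      by_cases hj : j = b
      · subst hj
        simpa using hlr
      · simpa [hj] using hρ j
    · intro j
      rcases lt_trichotomy j b with h | rfl | h
      · refine Or.inl fun k hk => ?_
        have h1 := hLq k (lt_of_le_of_lt (Fin.zero_le j) hk).ne'
        have h2 : (if j = 0 then 0 else if j < b then 1 else if j = b then l + 1 else
            (l + 2) / 2) ≤ 1 := by
          rw [if_pos h]
          split_ifs <;> simp
        omega
      · refine Or.inr ⟨?_, fun k hk => ?_⟩
        · rw [if_pos rfl]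
          refine Finset.sum_congr rfl fun k hk => ?_
          rw [if_neg (Finset.mem_filter.1 hk).2.ne', hrows]
        · simp only [hb0, hk.ne', hk.not_gt, (lt_of_le_of_lt (Fin.zero_le j) hk).ne', if_false,
            if_true, lt_irrefl]
          omega
      · refine Or.inl fun k hk => ?_
        have hbk := h.trans hk
        simp only [(lt_of_le_of_lt (Fin.zero_le b) h).ne', (lt_of_le_of_lt (Fin.zero_le b) hbk).ne',
          h.ne', h.not_gt, hbk.ne', hbk.not_gt, if_false]
        omega
    · intro j
      refine width _ ?_
      have h1 := hρ' j
      have h2 := hmono j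
      have h3 := hmono b
      have h4 := hpos b
      rcases lt_trichotomy j b with h | rfl | h
      · have h5 := hsmall j h.ne
        by_cases hj : j = 0
        · subst hj
          simp only [if_true, h.ne, if_false]
          push_cast
          linarith
        · simp only [hj, h, if_true, h.ne, if_false]
          push_cast
          linarith
      · simp only [hb0, if_true, lt_irrefl, if_false]
        push_cast
        linarith
      · have h5 := hsmall j h.ne'
        simp only [(lt_of_le_of_lt (Fin.zero_le b) h).ne', h.ne', h.not_gt, if_false]
        have h6 : (((l + 2) / 2 : ℕ) : ℝ) ≤ (l + 2) / 2 := by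
          exact_mod_cast Nat.cast_div_le (α := ℝ) (m := l + 2) (n := 2)
        have h7 : (0 : ℝ) ≤ r := by positivity
        push_cast at h6 ⊢
        linarith
    -- Later siblings are charged twice: for their own rows and for the empty rows above `b`.
    · have h1 := sum_rowBound_lt ch (Finset.univ.filter (b < ·)) fun j hj => by
        have hj : b < j := (Finset.mem_filter.1 hj).2
        linarith [hsmall j hj.ne', hmono b]
      simp only [hrows, Finset.sum_add_distrib, Finset.sum_ite_eq', Finset.mem_univ, if_true]
      omega
  · push Not at hbig
    refine fits_corner (L := fun _ => 0) (R := ρ) (h := fun j => rowBound (ch j).size - 1) hρ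
      (fun j => if j = 0 then 0 else 1) (fun _ => 0) rfl (by simp) (fun j hj => by simp [hj])
      ?_ ?_ ?_
    · refine fun j => Or.inl fun k hk => ?_
      simp only [(lt_of_le_of_lt (Fin.zero_le j) hk).ne', if_false]
      split_ifs <;> simp
    · intro j
      refine width _ ?_
      have h1 := hρ' j
      have h2 := hmono j
      by_cases hj : j = 0
      · rw [if_pos hj]
        push_cast
        linarith
      · have h3 := hbig j hj
        rw [if_neg hj]
        push_cast
        linarith
    · have h1 := sum_rowBound_lt ch ∅ (by simp)
      simp only [hrows, add_zero, Finset.sum_empty] at h1 ⊢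
      omega

theorem hasTopRightDrawing_of_smaller {T : OrderedTree}
    (hleft : ∀ T' : OrderedTree, T'.size ≤ T.size → HasTopLeftDrawing T') :
    HasTopRightDrawing T := by
  obtain ⟨T', hT, hsize⟩ := exists_isMirror T
  obtain ⟨r, h1, h2⟩ := hleft T' hsize.le
  rw [hsize] at h1 h2
  exact ⟨r, h1.of_isMirror hT, h2⟩

theorem has_drawings (n : ℕ) : ∀ T : OrderedTree, T.size ≤ n →
    HasTopDrawing T ∧ HasTopLeftDrawing T ∧ HasTopRightDrawing T := by
  induction n with
  | zero => exact fun T hT => absurd T.size_pos hT.not_gt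
  | succ n ih =>
    -- Settled for all trees of size n + 1 first, because the type IIIr drawing of a tree comes from
    -- its mirror image, which has the same size.
    have hleft : ∀ T : OrderedTree, T.size ≤ n + 1 → HasTopLeftDrawing T := fun T hT =>
      hasTopLeftDrawing_of_smaller (fun T' h => (ih T' (by omega)).2.1)
        fun T' h => (ih T' (by omega)).1
    exact fun T hT => ⟨hasTopDrawing_of_smaller (fun T' h => (ih T' (by omega)).2.1)
      fun T' h => (ih T' (by omega)).2.2, hleft T hT,
      hasTopRightDrawing_of_smaller fun T' h => hleft T' (h.trans hT)⟩

/-! ### Bounding boxes and the main theorem -/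

theorem Fits.exists_drawing {T : OrderedTree} {l r : ℕ} (H : Fits T l r (rowBound T.size - 1)) :
    ∃ Γ : StraightLineDrawing T, Γ.IsGLR ∧ Γ.IsStrictlyUpward ∧ Γ root = 0 ∧ Γ.topRow = 0 ∧
      -(l : ℤ) ≤ Γ.leftColumn ∧ Γ.leftColumn ≤ 0 ∧ 0 ≤ Γ.rightColumn ∧ Γ.rightColumn ≤ r ∧
      0 ≤ Γ.height ∧ (Γ.height : ℝ) ≤ (T.size : ℝ) ^ (37 / 25 : ℝ) := by
  obtain ⟨π, Γ, h1, h2, h3, -⟩ := H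
  have htop : Γ.topRow = 0 := by
    refine le_antisymm (Finset.sup'_le _ _ fun v _ => ?_) ?_
    · simpa [h2] using h1.le_root v
    · have : (Γ root).2 ≤ Γ.topRow := Finset.le_sup' (fun v => (Γ v).2) (Finset.mem_univ root)
      simpa [h2] using this
  have hbot : Γ.bottomRow ≤ 0 := by
    have : Γ.bottomRow ≤ (Γ root).2 := Finset.inf'_le (fun v => (Γ v).2) (Finset.mem_univ root)
    simpa [h2] using this
  have hbot' : -((rowBound T.size - 1 : ℕ) : ℤ) ≤ Γ.bottomRow :=
    Finset.le_inf' _ _ fun v _ => (h3 v).2.2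
  have hrow := one_le_rowBound T
  refine ⟨Γ, h1.isGLR, h1.isStrictlyUpward, h2, htop, Finset.le_inf' _ _ fun v _ => (h3 v).1, ?_, ?_,
    Finset.sup'_le _ _ fun v _ => (h3 v).2.1, ?_, ?_⟩
  · have : Γ.leftColumn ≤ (Γ root).1 := Finset.inf'_le (fun v => (Γ v).1) (Finset.mem_univ root)
    simpa [h2] using this
  · have : (Γ root).1 ≤ Γ.rightColumn := Finset.le_sup' (fun v => (Γ v).1) (Finset.mem_univ root)
    simpa [h2] using this
  · unfold StraightLineDrawing.height
    omega
  · have : Γ.height ≤ rowBound T.size := by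
      unfold StraightLineDrawing.height
      omega
    calc (Γ.height : ℝ) ≤ rowBound T.size := by exact_mod_cast this
      _ ≤ _ := Nat.floor_le (by positivity)

theorem StraightLineDrawing.area_le {T : OrderedTree} {Γ : StraightLineDrawing T}
    (hw : (Γ.width : ℝ) ≤ 20000 * (T.size : ℝ) ^ (12 / 25 : ℝ)) (h0 : 0 ≤ Γ.height)
    (hh : (Γ.height : ℝ) ≤ (T.size : ℝ) ^ (37 / 25 : ℝ)) :
    (Γ.area : ℝ) ≤ 20000 * (T.size : ℝ) ^ (49 / 25 : ℝ) := by
  have h0' : (0 : ℝ) ≤ Γ.height := by exact_mod_cast h0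
  have hT : (0 : ℝ) < T.size := by exact_mod_cast T.size_pos
  calc (Γ.area : ℝ) = Γ.width * Γ.height := by simp [area]
    _ ≤ 20000 * (T.size : ℝ) ^ (12 / 25 : ℝ) * (T.size : ℝ) ^ (37 / 25 : ℝ) := by gcongr
    _ = 20000 * (T.size : ℝ) ^ (49 / 25 : ℝ) := by
      rw [mul_assoc, ← Real.rpow_add hT]
      norm_num

end OrderedTree

theorem mainTheorem3 :
    ∃ c : ℝ, 0 < c ∧ ∃ C : ℝ, 0 < C ∧ ∀ T : OrderedTree,
      (∃ Γ : OrderedTree.StraightLineDrawing T,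
        Γ.IsGLR ∧ Γ.IsStrictlyUpward ∧ Γ.IsTypeI ∧
          (Γ.width : ℝ) ≤ c * (T.size : ℝ) ^ (0.48 : ℝ) - 1 ∧
          (Γ.height : ℝ) ≤ 2 * (T.size : ℝ) ^ (1 + 0.48 : ℝ) ∧
          (Γ.area : ℝ) ≤ C * (T.size : ℝ) ^ (1.96 : ℝ)) ∧
      (∃ Γ : OrderedTree.StraightLineDrawing T,
        Γ.IsGLR ∧ Γ.IsStrictlyUpward ∧ Γ.IsTypeIIIl ∧
          (Γ.width : ℝ) ≤ c * (T.size : ℝ) ^ (0.48 : ℝ) ∧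
          (Γ.height : ℝ) ≤ 2 * (T.size : ℝ) ^ (1 + 0.48 : ℝ) ∧
          (Γ.area : ℝ) ≤ C * (T.size : ℝ) ^ (1.96 : ℝ)) ∧
      (∃ Γ : OrderedTree.StraightLineDrawing T,
        Γ.IsGLR ∧ Γ.IsStrictlyUpward ∧ Γ.IsTypeIIIr ∧
          (Γ.width : ℝ) ≤ c * (T.size : ℝ) ^ (0.48 : ℝ) ∧
          (Γ.height : ℝ) ≤ 2 * (T.size : ℝ) ^ (1 + 0.48 : ℝ) ∧
          (Γ.area : ℝ) ≤ C * (T.size : ℝ) ^ (1.96 : ℝ)) := by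
  have e1 : (0.48 : ℝ) = 12 / 25 := by norm_num
  have e2 : (1 + 12 / 25 : ℝ) = 37 / 25 := by norm_num
  have e3 : (1.96 : ℝ) = 49 / 25 := by norm_num
  rw [e1, e2, e3]
  -- The heights obtained are at most n^(37/25), so the factor 2 in the height bound is slack.
  refine ⟨20000, by norm_num, 20000, by norm_num, fun T => ?_⟩
  obtain ⟨⟨l, r, h1, h2⟩, ⟨r', h1', h2'⟩, ⟨l'', h1'', h2''⟩⟩ :=
    OrderedTree.has_drawings T.size T le_rfl
  have hpos : 0 ≤ (T.size : ℝ) ^ (37 / 25 : ℝ) := by positivity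
  refine ⟨?_, ?_, ?_⟩
  · obtain ⟨Γ, hG, hU, hroot, htop, hl, hl', hr, hr', hh0, hh⟩ := h1.exists_drawing
    have hw : (Γ.width : ℝ) ≤ l + r + 1 := by
      exact_mod_cast (by unfold OrderedTree.StraightLineDrawing.width; omega :
        Γ.width ≤ l + r + 1)
    exact ⟨Γ, hG, hU, by simp [OrderedTree.StraightLineDrawing.IsTypeI, hroot, htop], by linarith,
      by linarith, OrderedTree.StraightLineDrawing.area_le (by linarith) hh0 hh⟩
  · obtain ⟨Γ, hG, hU, hroot, htop, hl, hl', hr, hr', hh0, hh⟩ := h1'.exists_drawing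
    have hcol : Γ.leftColumn = 0 := by omega
    have hw : (Γ.width : ℝ) ≤ r' + 1 := by
      exact_mod_cast (by unfold OrderedTree.StraightLineDrawing.width; omega :
        Γ.width ≤ r' + 1)
    exact ⟨Γ, hG, hU, by simp [OrderedTree.StraightLineDrawing.IsTypeIIIl, hroot, htop, hcol],
      by linarith, by linarith, OrderedTree.StraightLineDrawing.area_le (by linarith) hh0 hh⟩
  · obtain ⟨Γ, hG, hU, hroot, htop, hl, hl', hr, hr', hh0, hh⟩ := h1''.exists_drawing
    have hcol : Γ.rightColumn = 0 := by omega
    have hw : (Γ.width : ℝ) ≤ l'' + 1 := by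
      exact_mod_cast (by unfold OrderedTree.StraightLineDrawing.width; omega :
        Γ.width ≤ l'' + 1)
    exact ⟨Γ, hG, hU, by simp [OrderedTree.StraightLineDrawing.IsTypeIIIr, hroot, htop, hcol],
      by linarith, by linarith, OrderedTree.StraightLineDrawing.area_le (by linarith) hh0 hh⟩
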